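/- Let $\Bbbk$ be an algebraically closed field of any characteristic, let $V$ be a $\Bbbk$-vector space of dimension $n+1\ge 1$, and let $d$, $r$, $i$ be integers with $r\ge 1$ and $r-1\le i\le d-1$. Setting. Let $S=\Bbbk[\alpha_0,\dots,\alpha_n]=\bigoplus_e S^eV^*$ be the homogeneous coordinate ring of $\mathbb P_{\Bbbk}V$ and let $S^{(e)}V$ be the $e$-th symmetric (divided) tensor power of $V$, the dual space of $S^eV^*$. The homogeneous coordinate ring of $\mathbb P_{\Bbbk}(S^{(d)}V)$ is the polynomial ring on the vector space $S^dV^*$, that is, the polynomial ring in variables $z_m$, one for each monomial $m$ of degree $d$ in $\alpha_0,\dots,\alpha_n$. The Veronese variety $\nu_d(\mathbb P_{\Bbbk}V)\subset\mathbb P_{\Bbbk}(S^{(d)}V)$ is the closed subscheme whose homogeneous ideal is the kernel of the map $z_m\mapsto m\in S$. The $(i,d-i)$-th catalecticant matrix $\Upsilon^{i,d-i}$ has rows indexed by the monomials $a$ of degree $i$, columns indexed by the monomials $b$ of degree $d-i$, and entries the linear forms $z_{ab}$. The closed subscheme $\Upsilon^{i,d-i}_r=\{\operatorname{rk}\Upsilon^{i,d-i}\le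 r\}\subset\mathbb P_{\Bbbk}(S^{(d)}V)$ is the zero scheme of the ideal generated by its $(r+1)\times(r+1)$ minors. Cactus scheme. Let $W$ be a finite-dimensional $\Bbbk$-vector space and $X\subset\mathbb P_{\Bbbk}W$ a locally closed subscheme. A $\Bbbk$-scheme $Q$ has enough $\Bbbk$-points if it is locally Noetherian and the closure of each of its points contains a $\Bbbk$-point. A family over such a $Q$ of finite subschemes of $X$ tightly of degree at most $r'$ is a subscheme $\mathcal R\subset Q\times_{\Bbbk}X$ that is finite (not necessarily flat) over $Q$ and all of whose fibres over $\Bbbk$-points of $Q$ have degree exactly $r'$. It is independent if the degree of each fibre $R$ over a $\Bbbk$-point is equal to the dimension of the subspace of $W$ perpendicular to the linear forms that vanish on $R$. For an independent family, the linear span $\langle\mathcal R\rangle\subset Q\times_{\Bbbk}\mathbb P_{\Bbbk}W$ is the closed subscheme defined by the parts of degrees $0$ and $1$ of the homogeneous ideal sheaf of $\mathcal R$ in $\mathcal O_Q\otimes_{\Bbbk}\operatorname{Sym}W^*$, and the relative linear span of $\mathcal R$ is the scheme-theoretic image of $\langle\mathcal R\rangle$ in $\mathbb P_{\Bbbk}W$.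 The $r$-th cactus scheme of $X$ is the smallest closed subscheme of $\mathbb P_{\Bbbk}W$ that contains the relative linear spans of all independent families of finite subschemes of $X$ tightly of degree at most $r'$, over all $Q$ with enough $\Bbbk$-points and for all $r'\le r$. Theorem. The $r$-th cactus scheme of $\nu_d(\mathbb P_{\Bbbk}V)\subset\mathbb P_{\Bbbk}(S^{(d)}V)$ is contained, as a closed subscheme of $\mathbb P_{\Bbbk}(S^{(d)}V)$, in $\Upsilon^{i,d-i}_r$. -/

import Mathlib

open CategoryTheory CategoryTheory.Limits AlgebraicGeometry

universe u

namespace Cactus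

noncomputable section

attribute [local instance] MvPolynomial.gradedAlgebra

/-! ### Projective space and homogeneous equations -/

/-- The projective space `Proj k[x_s : s ∈ σ]`. -/
abbrev PSpace (σ : Type) (k : Type u) [Field k] : Scheme.{u} :=
  Proj (MvPolynomial.homogeneousSubmodule σ k)

/-- The structure morphism of projective space over `Spec k`. -/
def PSpace.toSpec (σ : Type) (k : Type u) [Field k] : PSpace σ k ⟶ Spec (.of k) :=
  Proj.toSpecZero (MvPolynomial.homogeneousSubmodule σ k) ≫
    Spec.map (CommRingCat.ofHom (algebraMap k (MvPolynomial.homogeneousSubmodule σ k 0)))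

/-- The standard chart `{x_j ≠ 0}` of projective space. -/
abbrev chart {σ : Type} (k : Type u) [Field k] (j : σ) : (PSpace σ k).Opens :=
  Proj.basicOpen (MvPolynomial.homogeneousSubmodule σ k) (MvPolynomial.X j)

/-- The regular function `x_i / x_j` on the chart `{x_j ≠ 0}`. -/
def ratio {σ : Type} (k : Type u) [Field k] (i j : σ) : Γ(PSpace σ k, chart k j) :=
  Proj.awayToSection (MvPolynomial.homogeneousSubmodule σ k) (MvPolynomial.X j)
    (HomogeneousLocalization.Away.mk (MvPolynomial.homogeneousSubmodule σ k)
      (MvPolynomial.isHomogeneous_X k j) 1 (MvPolynomial.X i)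
      (by simpa using MvPolynomial.isHomogeneous_X k i))

/-- Let `p : T ⟶ ℙ` be a morphism, `O ⊆ T` open, `φ : A → Γ(T, O)` a ring homomorphism and `F` a
homogeneous polynomial with coefficients in `A`. This says that the equation `F = 0` holds on `O`:
on `O ∩ p⁻¹ {x_j ≠ 0}`, the function `F (x / x_j)` is zero, for every `j`. -/
def FormVanishes {σ : Type} {k : Type u} [Field k] {T : Scheme.{u}} (p : T ⟶ PSpace σ k)
    (O : T.Opens) {A : Type u} [CommRing A] (φ : A →+* Γ(T, O)) (F : MvPolynomial σ A) : Prop :=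
  ∀ j : σ, MvPolynomial.eval₂
    ((T.presheaf.map (homOfLE (inf_le_left : O ⊓ p ⁻¹ᵁ chart k j ≤ O)).op).hom.comp φ)
    (fun i => (T.presheaf.map
        (homOfLE (inf_le_right : O ⊓ p ⁻¹ᵁ chart k j ≤ p ⁻¹ᵁ chart k j)).op).hom
      ((p.app (chart k j)).hom (ratio k i j))) F = 0

/-- The ring homomorphism `k → Γ(T, ⊤)` of a `k`-scheme `T`. -/
def scalars {k : Type u} [Field k] {T : Scheme.{u}} (s : T ⟶ Spec (.of k)) : k →+* Γ(T, ⊤) :=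
  ((Scheme.ΓSpecIso (.of k)).inv ≫ s.appTop).hom

/-- The homogeneous polynomial `F` over `k` vanishes on `T`, where `p : T ⟶ ℙ`. -/
def VanishesOn {σ : Type} {k : Type u} [Field k] {T : Scheme.{u}} (p : T ⟶ PSpace σ k)
    (F : MvPolynomial σ k) : Prop :=
  FormVanishes p ⊤ (scalars (p ≫ PSpace.toSpec σ k)) F

/-- The ideal sheaf of the zero scheme in projective space of a homogeneous ideal `I`, that is of
the largest closed subscheme on which all the homogeneous elements of `I` vanish. -/
def zeroScheme {σ : Type} {k : Type u} [Field k] (I : Ideal (MvPolynomial σ k)) :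
    (PSpace σ k).IdealSheafData :=
  sInf {J | ∀ (e : ℕ) (F : MvPolynomial σ k), F ∈ I → F.IsHomogeneous e →
    VanishesOn J.subschemeι F}

/-! ### Finite subschemes and their linear spans -/

/-- The dimension over `k` of the ring of global functions; the degree (length) of `T` if `T` is
finite over `k`. -/
def degree {k : Type u} [Field k] {T : Scheme.{u}} (s : T ⟶ Spec (.of k)) : ℕ :=
  letI : Module k Γ(T, ⊤) := (scalars s).toAlgebra.toModule
  Module.finrank k Γ(T, ⊤)

/-- The linear subspace `W'` of `W = k^σ` perpendicular to the linear forms that vanish on `T`,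
where `p : T ⟶ ℙ W`. -/
def affineSpan {σ : Type} [Fintype σ] {k : Type u} [Field k] {T : Scheme.{u}}
    (p : T ⟶ PSpace σ k) : Submodule k (σ → k) where
  carrier := {w | ∀ a : σ → k,
    VanishesOn p (∑ i, MvPolynomial.C (a i) * MvPolynomial.X i) → a ⬝ᵥ w = 0}
  add_mem' hv hw a ha := by rw [dotProduct_add, hv a ha, hw a ha, add_zero]
  zero_mem' a _ := dotProduct_zero a
  smul_mem' c w hw a ha := by rw [dotProduct_smul, hw a ha, smul_zero]

/-! ### Families of subschemes -/

/-- `Q` is locally Noetherian, and the closure of every point contains a `k`-point. -/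
def HasEnoughPoints {k : Type u} [Field k] {Q : Scheme.{u}} (s : Q ⟶ Spec (.of k)) : Prop :=
  IsLocallyNoetherian Q ∧ ∀ w : Q, ∃ q : Spec (.of k) ⟶ Q, q ≫ s = 𝟙 _ ∧
    ∃ y : Spec (.of k), q y ∈ closure {w}

/-- A family over a `k`-scheme `Q` of subschemes of `X`, where `X` is a subscheme of `ℙ` by `i`:
a subscheme `R` of `Q ×ₖ X`, with its projections to `Q` and `X`. -/
structure Family {σ : Type} {k : Type u} [Field k] {X : Scheme.{u}} (i : X ⟶ PSpace σ k) where
  /-- the base -/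
  Q : Scheme.{u}
  /-- the structure morphism of the base -/
  base : Q ⟶ Spec (.of k)
  /-- the total space -/
  R : Scheme.{u}
  /-- the projection to the base -/
  toBase : R ⟶ Q
  /-- the projection to `X` -/
  toX : R ⟶ X
  comm : toBase ≫ base = toX ≫ i ≫ PSpace.toSpec σ k
  isImmersion : IsImmersion
    (pullback.lift toBase toX comm : R ⟶ pullback base (i ≫ PSpace.toSpec σ k))

namespace Family

variable {σ : Type} {k : Type u} [Field k] {X : Scheme.{u}} {i : X ⟶ PSpace σ k} (𝓡 : Family i)

/-- The morphism from the total space to projective space. -/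
def toP : 𝓡.R ⟶ PSpace σ k := 𝓡.toX ≫ i

/-- The `k`-points of the base. -/
def Point : Type u := {q : Spec (.of k) ⟶ 𝓡.Q // q ≫ 𝓡.base = 𝟙 _}

/-- The scheme-theoretic fibre over a `k`-point. -/
def fibre (q : 𝓡.Point) : Scheme.{u} := pullback 𝓡.toBase q.1

/-- The structure morphism of a fibre. -/
def fibreToSpec (q : 𝓡.Point) : 𝓡.fibre q ⟶ Spec (.of k) := pullback.snd 𝓡.toBase q.1

/-- The inclusion of a fibre in projective space. -/
def fibreToP (q : 𝓡.Point) : 𝓡.fibre q ⟶ PSpace σ k := pullback.fst 𝓡.toBase q.1 ≫ 𝓡.toP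

/-- A family of finite subschemes tightly of degree at most `r`: the base has enough `k`-points,
the total space is finite over the base, and all the fibres over `k`-points have degree
exactly `r`. Flatness is not required. -/
structure IsTight (r : ℕ) : Prop where
  enough : HasEnoughPoints 𝓡.base
  finite : IsFinite 𝓡.toBase
  degree_fibre (q : 𝓡.Point) : degree (𝓡.fibreToSpec q) = r

/-- The total space is finite over the base, and all the fibres over `k`-points are linearly
independent: their degree is the dimension of their affine linear span. -/
structure IsIndependent [Fintype σ] : Prop where
  finite : IsFinite 𝓡.toBase
  finrank_affineSpan (q : 𝓡.Point) :
    Module.finrank k (affineSpan (𝓡.fibreToP q)) = degree (𝓡.fibreToSpec q)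

/-- The product `Q ×ₖ ℙ`, in which the linear span of the family lies. -/
abbrev ambient : Scheme.{u} := pullback 𝓡.base (PSpace.toSpec σ k)

/-- `F` is a form over the open set `U` of the base that vanishes on the part over `U` of the
family: an element of the homogeneous ideal sheaf of `R ⊆ Q ×ₖ ℙ`. -/
def InIdeal (U : 𝓡.Q.Opens) (F : MvPolynomial σ Γ(𝓡.Q, U)) : Prop :=
  FormVanishes 𝓡.toP (𝓡.toBase ⁻¹ᵁ U) (𝓡.toBase.app U).hom F

/-- The ideal sheaf on `Q ×ₖ ℙ` of the linear span of the family, which is the closed subscheme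
defined by the forms of degree at most `1` in the homogeneous ideal sheaf of `R`, over all the open
sets of `Q`: the largest closed subscheme on which all these forms vanish. -/
def span : 𝓡.ambient.IdealSheafData :=
  sInf {J | ∀ (U : 𝓡.Q.Opens) (e : ℕ) (F : MvPolynomial σ Γ(𝓡.Q, U)), e ≤ 1 → F.IsHomogeneous e →
    𝓡.InIdeal U F →
    FormVanishes (J.subschemeι ≫ pullback.snd 𝓡.base (PSpace.toSpec σ k))
      ((J.subschemeι ≫ pullback.fst 𝓡.base (PSpace.toSpec σ k)) ⁻¹ᵁ U)
      ((J.subschemeι ≫ pullback.fst 𝓡.base (PSpace.toSpec σ k)).app U).hom F}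

/-- The ideal sheaf on `ℙ` of the relative linear span of the family: the scheme-theoretic image
of the linear span under the projection `Q ×ₖ ℙ ⟶ ℙ`. -/
def relSpan : (PSpace σ k).IdealSheafData :=
  (𝓡.span.subschemeι ≫ pullback.snd 𝓡.base (PSpace.toSpec σ k)).ker

end Family

/-- The ideal sheaf on `ℙ` of the `r`-th cactus scheme of a subscheme `i : X ⟶ ℙ`: the smallest
closed subscheme that contains the relative linear spans of all the independent families of finite
subschemes of `X` tightly of degree at most `r'`, for all `r' ≤ r`. -/
def cactus {σ : Type} [Fintype σ] {k : Type u} [Field k] {X : Scheme.{u}} (i : X ⟶ PSpace σ k)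
    [IsImmersion i] (r : ℕ) : (PSpace σ k).IdealSheafData :=
  sInf {J | ∃ (𝓡 : Family i) (r' : ℕ), r' ≤ r ∧ 𝓡.IsTight r' ∧ 𝓡.IsIndependent ∧ J = 𝓡.relSpan}

/-! ### Veronese varieties and catalecticant minors -/

/-- The exponents of the monomials of degree `d` in `n + 1` variables. The monomials form a basis of
the space of linear forms on the divided power `S^(d) V`, for `V` of dimension `n + 1`. -/
abbrev Mon (n d : ℕ) : Type := {m : Fin (n + 1) →₀ ℕ // m.degree = d}

instance Mon.instFintype (n d : ℕ) : Fintype (Mon n d) :=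
  (Finsupp.finite_of_degree_eq (σ := Fin (n + 1)) d).fintype

/-- The homogeneous ideal of the Veronese variety `ν_d(ℙV) ⊆ ℙ(S^(d) V)`: the polynomials that
vanish identically when the coordinate `z_m` is replaced by the monomial with exponent `m`. -/
def veroneseIdeal (k : Type u) [Field k] (n d : ℕ) : Ideal (MvPolynomial (Mon n d) k) :=
  RingHom.ker (MvPolynomial.aeval (R := k) fun m : Mon n d =>
    (MvPolynomial.monomial m.1 (1 : k) : MvPolynomial (Fin (n + 1)) k))

/-- The Veronese variety, as a closed subscheme of `ℙ(S^(d) V)`. -/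
abbrev veronese (k : Type u) [Field k] (n d : ℕ) : (PSpace (Mon n d) k).IdealSheafData :=
  zeroScheme (veroneseIdeal k n d)

/-- The `(i, d - i)`-th catalecticant matrix: its entry at a monomial of degree `i` and a monomial
of degree `d - i` is their product, as a linear form on `S^(d) V`. -/
def catalecticant (k : Type u) [Field k] (n d i : ℕ) (hi : i ≤ d) :
    Matrix (Mon n i) (Mon n (d - i)) (MvPolynomial (Mon n d) k) :=
  Matrix.of fun a b => MvPolynomial.X ⟨a.1 + b.1, by
    rw [map_add, a.2, b.2, Nat.add_sub_cancel' hi]⟩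

/-- The ideal generated by the `s × s` minors of a matrix. -/
def minorsIdeal {A : Type*} [CommRing A] {α β : Type*} (M : Matrix α β A) (s : ℕ) : Ideal A :=
  Ideal.span {F | ∃ (f : Fin s → α) (g : Fin s → β), F = (M.submatrix f g).det}

/-- The zero scheme of the `(r + 1) × (r + 1)` minors of the catalecticant matrix. -/
abbrev upsilon (k : Type u) [Field k] (n d i : ℕ) (hi : i ≤ d) (r : ℕ) :
    (PSpace (Mon n d) k).IdealSheafData :=
  zeroScheme (minorsIdeal (catalecticant k n d i hi) (r + 1))

end

end Cactus

/-!
The linear equations of a family of subschemes of the Veronese variety of degree `r' ≤ r ≤ i + 1`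
force, locally on the base, the rows of the catalecticant matrix to be combinations of `r'` rows.

Over a `k`-point `q` of the base, the fibre is a finite subscheme `Z` of the Veronese variety. As
`k` is infinite, some linear form `h` on `V` vanishes at no point of `Z`, and then `h ^ d` has no
zeros on the family over a neighbourhood of `q` (`Family.exists_affine_nhd`). Over it, the
coordinates `z_m / h ^ d` are the monomials `y ^ m` in the functions `y_l = α_l h ^ (d - 1) / h ^ d`
(`Family.coord_eq_prod`), of which `1` is a linear combination, and the `y_l` generate the functions
on `Z`. The spaces of forms of degree `0, 1, 2, …` in the `y_l` grow strictly until they exhaust the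
functions on `Z`, so the monomials of degree `i` span the functions on `Z`, because `deg Z ≤ i + 1`
(`span_monomials_eq_top`); `r'` of them, `y ^ (s_1), …, y ^ (s_r')`, already do. By Nakayama's lemma
(`exists_smul_mem_span`) there is a function `f` on the base with `f(q) = 1` such that `f y ^ a = ∑
g_{a,l} y ^ (s_l)` on the family, for all `a` of degree `i`. Multiplication by `y ^ b`, for `b` of
degree `d - i`, gives the linear equations `f z_{ab} = ∑ g_{a,l} z_{s_l b}` of the family
(`Family.exists_syzygies`). They hold on the linear span, and say that where `f` is invertible all
the rows of the catalecticant matrix are combinations of `r'` rows. Hence its minors of size `r + 1`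
vanish there (`minor_eq_zero`). The neighbourhoods of the `k`-points cover the base because the
closure of every point contains a `k`-point (`Family.IsTight.vanishesOn_minor`).

It remains to pass between equations and ideal sheaves. A morphism to projective space on which the
forms of a homogeneous ideal vanish factors through its zero scheme (`zeroScheme_le_ker`), and these
forms do vanish on the zero scheme itself (`vanishesOn_zeroScheme`), which is how the equations of
the Veronese variety become available. The ideal sheaf of the linear span is an infimum over closed
subschemes on which the linear equations hold, and the minors are shown to vanish on each of these,
so that the adjunction between direct and inverse images of ideal sheaves gives the inclusion
(`Family.IsTight.upsilon_le_relSpan`).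
-/

namespace Cactus

noncomputable section

/-- A fraction `F / f ^ e` does not vanish at the points of `{f ≠ 0}` at which `F` does not
vanish. -/
lemma mem_basicOpen_awayToSection {R A : Type u} [CommRing R] [CommRing A] [Algebra R A]
    (𝒜 : ℕ → Submodule R A) [GradedAlgebra 𝒜] (f : A) {x : Proj 𝒜}
    (hx : x ∈ Proj.basicOpen 𝒜 f)
    (c : HomogeneousLocalization.NumDenSameDeg 𝒜 (Submonoid.powers f))
    (hc : c.num.1 ∉ x.asHomogeneousIdeal.toIdeal) :
    x ∈ (Proj 𝒜).basicOpen (Proj.awayToSection 𝒜 f (HomogeneousLocalization.mk c)) := by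
  rw [Scheme.mem_basicOpen _ _ _ hx]
  have h := ProjectiveSpectrum.Proj.awayToSection_germ 𝒜 f x hx
  have hprime : x.asHomogeneousIdeal.toIdeal.IsPrime := ProjectiveSpectrum.isPrime x
  have hf : f ∈ x.asHomogeneousIdeal.toIdeal.primeCompl := hx
  have h2 := congr($(h).hom (HomogeneousLocalization.mk c))
  have h3 : IsUnit (HomogeneousLocalization.mapId 𝒜 (Submonoid.powers_le.mpr hf)
      (HomogeneousLocalization.mk c) :
        HomogeneousLocalization.AtPrime 𝒜 x.asHomogeneousIdeal.toIdeal) := by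
    rw [← HomogeneousLocalization.isUnit_iff_isUnit_val]
    have : (HomogeneousLocalization.mapId 𝒜 (Submonoid.powers_le.mpr hf)
      (HomogeneousLocalization.mk c) :
        HomogeneousLocalization.AtPrime 𝒜 x.asHomogeneousIdeal.toIdeal).val =
        Localization.mk c.num.1 ⟨c.den.1, Submonoid.powers_le.mpr hf c.den_mem⟩ := rfl
    rw [this, Localization.mk_eq_mk', IsLocalization.AtPrime.isUnit_mk'_iff]
    exact hc
  exact (congrArg IsUnit h2).mpr (h3.map (Proj.stalkIso' 𝒜 x).symm)

attribute [local instance] MvPolynomial.gradedAlgebra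

/-! ### Coordinates on schemes over projective space -/

section Coordinates

variable {σ : Type} {k : Type u} [Field k]

/-- The open set `{L ≠ 0}` of projective space. -/
abbrev nonzeroLocus (L : MvPolynomial σ k) : (PSpace σ k).Opens :=
  Proj.basicOpen (MvPolynomial.homogeneousSubmodule σ k) L

/-- The regular function `F / L ^ e` on `{L ≠ 0}`, for a linear form `L` and a form `F` of
degree `e`. -/
def fraction {L : MvPolynomial σ k} (hL : L.IsHomogeneous 1) {e : ℕ} {F : MvPolynomial σ k}
    (hF : F.IsHomogeneous e) : Γ(PSpace σ k, nonzeroLocus L) :=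
  Proj.awayToSection (MvPolynomial.homogeneousSubmodule σ k) L
    (HomogeneousLocalization.Away.mk (MvPolynomial.homogeneousSubmodule σ k)
      ((MvPolynomial.mem_homogeneousSubmodule 1 L).mpr hL) e F (by simpa using hF))

/-- The function `x_i / L` on an open set `O` that a morphism to projective space maps into
`{L ≠ 0}`. -/
def coord {T : Scheme.{u}} (p : T ⟶ PSpace σ k) {L : MvPolynomial σ k} (hL : L.IsHomogeneous 1)
    (O : T.Opens) (hO : O ≤ p ⁻¹ᵁ nonzeroLocus L) (i : σ) : Γ(T, O) :=
  (p.appLE _ O hO).hom (fraction hL (MvPolynomial.isHomogeneous_X k i))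

/-- The ring homomorphism from `k` to the functions on an open set of a scheme over `ℙ`. -/
def scalarsOn {T : Scheme.{u}} (p : T ⟶ PSpace σ k) (O : T.Opens) : k →+* Γ(T, O) :=
  (T.presheaf.map (homOfLE le_top : O ⟶ ⊤).op).hom.comp (scalars (p ≫ PSpace.toSpec σ k))

/-- The constants, as elements of the degree zero part of the localization at `L`. -/
def constants (L : MvPolynomial σ k) :
    k →+* HomogeneousLocalization.Away (MvPolynomial.homogeneousSubmodule σ k) L :=
  (HomogeneousLocalization.fromZeroRingHom (MvPolynomial.homogeneousSubmodule σ k) _).comp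
    (algebraMap k (MvPolynomial.homogeneousSubmodule σ k 0))

/-- On `{L ≠ 0}`, the structure morphism of projective space corresponds to the constants. -/
lemma ι_toSpec {L : MvPolynomial σ k} (hL : L.IsHomogeneous 1) :
    (nonzeroLocus L).ι ≫ PSpace.toSpec σ k =
      (nonzeroLocus L).toSpecΓ ≫ Spec.map (CommRingCat.ofHom (constants L) ≫
        Proj.awayToSection _ L) := by
  have hL' : L ∈ MvPolynomial.homogeneousSubmodule σ k 1 := hL
  have h := Proj.awayι_toSpecZero (MvPolynomial.homogeneousSubmodule σ k) L hL' one_pos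
  rw [← Proj.basicOpenIsoSpec_inv_ι, Category.assoc, Iso.inv_comp_eq, Proj.basicOpenIsoSpec_hom,
    Proj.basicOpenToSpec, Category.assoc] at h
  rw [PSpace.toSpec, reassoc_of% h, ← Spec.map_comp, ← Spec.map_comp]
  rfl

lemma le_preimage_top {X Y : Scheme.{u}} (f : X ⟶ Y) (O : X.Opens) : O ≤ f ⁻¹ᵁ ⊤ :=
  fun _ _ => trivial

lemma toSpec_appLE {L : MvPolynomial σ k} (hL : L.IsHomogeneous 1) :
    (Scheme.ΓSpecIso (.of k)).inv ≫ (PSpace.toSpec σ k).appLE ⊤ (nonzeroLocus L)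
      (le_preimage_top _ _) = CommRingCat.ofHom (constants L) ≫ Proj.awayToSection _ L := by
  have h := congr(($(ι_toSpec hL)).appTop ≫ (nonzeroLocus L).topIso.hom)
  simp only [Scheme.Hom.comp_appTop, Category.assoc, Scheme.Opens.toSpecΓ_appTop,
    Iso.inv_hom_id, Category.comp_id] at h
  rw [Iso.inv_comp_eq]
  trans Scheme.Hom.appTop (PSpace.toSpec σ k) ≫ Scheme.Hom.appTop (nonzeroLocus L).ι ≫
    (nonzeroLocus L).topIso.hom
  · rw [Scheme.Hom.appLE]
    rfl
  · rw [h, Scheme.ΓSpecIso_naturality]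

variable {T : Scheme.{u}} (p : T ⟶ PSpace σ k)

lemma appLE_constants {L : MvPolynomial σ k} (hL : L.IsHomogeneous 1) (O : T.Opens)
    (hO : O ≤ p ⁻¹ᵁ nonzeroLocus L) (c : k) :
    (p.appLE _ O hO).hom (Proj.awayToSection (MvPolynomial.homogeneousSubmodule σ k) L
      (constants L c)) = scalarsOn p O c := by
  have h := congr(($(toSpec_appLE hL) ≫ p.appLE _ O hO).hom c)
  rw [Category.assoc, Scheme.Hom.appLE_comp_appLE] at h
  refine (Eq.trans ?_ h.symm).trans ?_
  · rfl
  · have : (p ≫ PSpace.toSpec σ k).appLE ⊤ O (le_preimage_top _ _) =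
      (p ≫ PSpace.toSpec σ k).appTop ≫ (T.presheaf.map (homOfLE le_top : O ⟶ ⊤).op) := rfl
    rw [this]
    rfl

lemma coord_res {L : MvPolynomial σ k} (hL : L.IsHomogeneous 1) {O O' : T.Opens} (h : O' ≤ O)
    (hO : O ≤ p ⁻¹ᵁ nonzeroLocus L) (i : σ) :
    (T.presheaf.map (homOfLE h).op).hom (coord p hL O hO i) = coord p hL O' (h.trans hO) i := by
  rw [coord, coord, ← Scheme.Hom.appLE_map p hO (homOfLE h).op]
  rfl

lemma scalarsOn_comp {T' : Scheme.{u}} (g : T' ⟶ T) {O : T.Opens} {O' : T'.Opens}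
    (h : O' ≤ g ⁻¹ᵁ O) : (g.appLE O O' h).hom.comp (scalarsOn p O) = scalarsOn (g ≫ p) O' := by
  have (U : T.Opens) : scalarsOn p U = ((Scheme.ΓSpecIso (.of k)).inv ≫
    (p ≫ PSpace.toSpec σ k).appLE ⊤ U (le_preimage_top _ _)).hom := rfl
  have h2 : scalarsOn (g ≫ p) O' = ((Scheme.ΓSpecIso (.of k)).inv ≫
    (g ≫ p ≫ PSpace.toSpec σ k).appLE ⊤ O' (le_preimage_top _ _)).hom := by
    simp only [← Category.assoc]
    rfl
  rw [this, h2, ← CommRingCat.hom_comp, Category.assoc, Scheme.Hom.appLE_comp_appLE]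

lemma coord_comp {T' : Scheme.{u}} (g : T' ⟶ T) {L : MvPolynomial σ k} (hL : L.IsHomogeneous 1)
    {O : T.Opens} {O' : T'.Opens} (h : O' ≤ g ⁻¹ᵁ O)
    (hO : O ≤ p ⁻¹ᵁ nonzeroLocus L) (hO' : O' ≤ (g ≫ p) ⁻¹ᵁ nonzeroLocus L) (i : σ) :
    (g.appLE O O' h).hom (coord p hL O hO i) = coord (g ≫ p) hL O' hO' i := by
  rw [coord, coord, ← Scheme.Hom.appLE_comp_appLE g p _ O O' hO h]
  rfl

lemma eval₂_smul {A B : Type*} [CommRing A] [CommRing B] (φ : A →+* B) (c : B) (x : σ → B)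
    {e : ℕ} {F : MvPolynomial σ A} (hF : F.IsHomogeneous e) :
    F.eval₂ φ (fun i => c * x i) = c ^ e * F.eval₂ φ x := by
  rw [MvPolynomial.eval₂_eq, MvPolynomial.eval₂_eq, Finset.mul_sum]
  refine Finset.sum_congr rfl fun m hm => ?_
  have : m.degree = e := by
    have := hF (MvPolynomial.mem_support_iff.mp hm)
    rw [Finsupp.degree_eq_weight_one]
    exact this
  simp_rw [mul_pow, Finset.prod_mul_distrib, Finset.prod_pow_eq_pow_sum]
  rw [← this, Finsupp.degree_apply]
  ring

/-- The value of a form `F` of degree `e` at the coordinates `x_i / L` is the function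
`F / L ^ e`. -/
lemma eval₂_coord {L : MvPolynomial σ k} (hL : L.IsHomogeneous 1) (O : T.Opens)
    (hO : O ≤ p ⁻¹ᵁ nonzeroLocus L) {e : ℕ} {F : MvPolynomial σ k} (hF : F.IsHomogeneous e) :
    F.eval₂ (scalarsOn p O) (coord p hL O hO) = (p.appLE _ O hO).hom (fraction hL hF) := by
  have h1 : scalarsOn p O = ((p.appLE _ O hO).hom.comp
      (Proj.awayToSection (MvPolynomial.homogeneousSubmodule σ k) L).hom).comp (constants L) := by
    ext c
    exact (appLE_constants p hL O hO c).symm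
  rw [h1]
  have hL' := (MvPolynomial.mem_homogeneousSubmodule 1 L).mpr hL
  refine (MvPolynomial.hom_eval₂ F (constants L) ((p.appLE _ O hO).hom.comp
      (Proj.awayToSection (MvPolynomial.homogeneousSubmodule σ k) L).hom) (fun i =>
        HomogeneousLocalization.Away.mk (MvPolynomial.homogeneousSubmodule σ k) hL' 1
        (MvPolynomial.X i) (by simpa using MvPolynomial.isHomogeneous_X k i))).symm.trans ?_
  rw [fraction, RingHom.comp_apply]
  congr 2
  ext
  rw [HomogeneousLocalization.Away.val_mk, ← HomogeneousLocalization.algebraMap_apply,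
    MvPolynomial.hom_eval₂]
  have h2 : (algebraMap (HomogeneousLocalization.Away (MvPolynomial.homogeneousSubmodule σ k) L)
      (Localization.Away L)).comp (constants L) =
      (algebraMap (MvPolynomial σ k) (Localization.Away L)).comp MvPolynomial.C := by
    ext c
    rfl
  have h3 : (fun i => algebraMap (HomogeneousLocalization.Away
      (MvPolynomial.homogeneousSubmodule σ k) L) (Localization.Away L)
      (HomogeneousLocalization.Away.mk (MvPolynomial.homogeneousSubmodule σ k) hL' 1
        (MvPolynomial.X i) (by simpa using MvPolynomial.isHomogeneous_X k i))) =
      fun i => (Localization.mk 1 ⟨L, Submonoid.mem_powers L⟩ : Localization.Away L) *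
        algebraMap (MvPolynomial σ k) (Localization.Away L) (MvPolynomial.X i) := by
    ext i
    rw [HomogeneousLocalization.algebraMap_apply, HomogeneousLocalization.Away.val_mk,
      ← Localization.mk_one_eq_algebraMap, Localization.mk_mul]
    simp
  rw [h2]
  refine (congrArg (fun x => MvPolynomial.eval₂ _ x F) h3).trans ?_
  -- homogeneity turns `F (L⁻¹ x)` into `L ^ (-e) F (x)`
  rw [eval₂_smul _ _ _ hF, ← MvPolynomial.hom_eval₂, MvPolynomial.eval₂_eta, Localization.mk_pow,
    ← Localization.mk_one_eq_algebraMap, Localization.mk_mul]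
  simp

/-- On `{L M ≠ 0}` one has `F / L = (M / L) (F / M)` for linear forms `F`, `L`, `M`. -/
lemma fraction_mul {L M F : MvPolynomial σ k} (hL : L.IsHomogeneous 1) (hM : M.IsHomogeneous 1)
    (hF : F.IsHomogeneous 1) (O : T.Opens) (hOL : O ≤ p ⁻¹ᵁ nonzeroLocus L)
    (hOM : O ≤ p ⁻¹ᵁ nonzeroLocus M) :
    (p.appLE _ O hOL).hom (fraction hL hF) =
      (p.appLE _ O hOL).hom (fraction hL hM) * (p.appLE _ O hOM).hom (fraction hM hF) := by
  have hL' := (MvPolynomial.mem_homogeneousSubmodule 1 L).mpr hL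
  have hM' := (MvPolynomial.mem_homogeneousSubmodule 1 M).mpr hM
  have hO : O ≤ p ⁻¹ᵁ nonzeroLocus (L * M) := by
    rw [nonzeroLocus, Proj.basicOpen_mul]
    exact le_inf hOL hOM
  have h1 (z) : (p.appLE _ O hOL).hom (Proj.awayToSection
      (MvPolynomial.homogeneousSubmodule σ k) L z) = (p.appLE _ O hO).hom
        (Proj.awayToSection (MvPolynomial.homogeneousSubmodule σ k) (L * M)
          (HomogeneousLocalization.awayMap _ hM' rfl z)) := by
    have h := congr($(Proj.awayMap_awayToSection (MvPolynomial.homogeneousSubmodule σ k)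
      (f := L) hM' rfl) ≫ p.appLE _ O hO)
    rw [Category.assoc, Category.assoc, Scheme.Hom.map_appLE] at h
    exact (congr($(h).hom z)).symm
  have h2 (z) : (p.appLE _ O hOM).hom (Proj.awayToSection
      (MvPolynomial.homogeneousSubmodule σ k) M z) = (p.appLE _ O hO).hom
        (Proj.awayToSection (MvPolynomial.homogeneousSubmodule σ k) (L * M)
          (HomogeneousLocalization.awayMap _ hL' (mul_comm L M) z)) := by
    have h := congr($(Proj.awayMap_awayToSection (MvPolynomial.homogeneousSubmodule σ k)
      (f := M) hL' (mul_comm L M)) ≫ p.appLE _ O hO)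
    rw [Category.assoc, Category.assoc, Scheme.Hom.map_appLE] at h
    exact (congr($(h).hom z)).symm
  -- compare both sides on `{L M ≠ 0}`
  rw [fraction, fraction, fraction, h1, h1, h2, ← map_mul, ← map_mul]
  congr 2
  rw [HomogeneousLocalization.awayMap_mk, HomogeneousLocalization.awayMap_mk,
    HomogeneousLocalization.awayMap_mk]
  ext
  simp only [HomogeneousLocalization.val_mul, HomogeneousLocalization.Away.val_mk,
    Localization.mk_mul]
  refine Localization.mk_eq_mk_iff.mpr (Localization.r_iff_exists.mpr ⟨1, ?_⟩)
  simp
  ring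

lemma fraction_self {L : MvPolynomial σ k} (hL : L.IsHomogeneous 1) : fraction hL hL = 1 := by
  have : HomogeneousLocalization.Away.mk (MvPolynomial.homogeneousSubmodule σ k)
      ((MvPolynomial.mem_homogeneousSubmodule 1 L).mpr hL) 1 L (by simpa using hL) = 1 := by
    ext
    rw [HomogeneousLocalization.Away.val_mk, HomogeneousLocalization.val_one,
      Localization.mk_eq_monoidOf_mk', Submonoid.LocalizationMap.mk'_eq_iff_eq_mul]
    simp
  rw [fraction, this]
  exact map_one (Proj.awayToSection (MvPolynomial.homogeneousSubmodule σ k) L).hom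

lemma isUnit_fraction {L M : MvPolynomial σ k} (hL : L.IsHomogeneous 1) (hM : M.IsHomogeneous 1)
    (O : T.Opens) (hOL : O ≤ p ⁻¹ᵁ nonzeroLocus L) (hOM : O ≤ p ⁻¹ᵁ nonzeroLocus M) :
    IsUnit ((p.appLE _ O hOL).hom (fraction hL hM)) := by
  refine IsUnit.of_mul_eq_one ((p.appLE _ O hOM).hom (fraction hM hL)) ?_
  rw [← fraction_mul p hL hM hL O hOL hOM, fraction_self, map_one]

/-- The vanishing of a form does not depend on the linear form used as denominator. -/
lemma eval₂_coord_eq_zero_iff {L M : MvPolynomial σ k} (hL : L.IsHomogeneous 1)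
    (hM : M.IsHomogeneous 1) (O : T.Opens) (hOL : O ≤ p ⁻¹ᵁ nonzeroLocus L)
    (hOM : O ≤ p ⁻¹ᵁ nonzeroLocus M) {A : Type*} [CommRing A] (φ : A →+* Γ(T, O)) {e : ℕ}
    {F : MvPolynomial σ A} (hF : F.IsHomogeneous e) :
    F.eval₂ φ (coord p hL O hOL) = 0 ↔ F.eval₂ φ (coord p hM O hOM) = 0 := by
  have : coord p hL O hOL = fun i =>
      (p.appLE _ O hOL).hom (fraction hL hM) * coord p hM O hOM i :=
    funext fun i => fraction_mul p hL hM (MvPolynomial.isHomogeneous_X k i) O hOL hOM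
  rw [this, eval₂_smul _ _ _ hF]
  exact ((isUnit_fraction p hL hM O hOL hOM).pow e).mul_right_eq_zero

lemma formVanishes_iff_charts {O : T.Opens} {A : Type u} [CommRing A] {φ : A →+* Γ(T, O)}
    {F : MvPolynomial σ A} : FormVanishes p O φ F ↔ ∀ j, F.eval₂
      ((T.presheaf.map (homOfLE (inf_le_left : O ⊓ p ⁻¹ᵁ chart k j ≤ O)).op).hom.comp φ)
      (coord p (MvPolynomial.isHomogeneous_X k j) (O ⊓ p ⁻¹ᵁ chart k j) inf_le_right) = 0 :=
  Iff.rfl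

lemma res_eval₂_coord {L : MvPolynomial σ k} (hL : L.IsHomogeneous 1) {O O' : T.Opens}
    (h : O' ≤ O) (hO : O ≤ p ⁻¹ᵁ nonzeroLocus L) {A : Type*} [CommRing A] (φ : A →+* Γ(T, O))
    (F : MvPolynomial σ A) :
    (T.presheaf.map (homOfLE h).op).hom (F.eval₂ φ (coord p hL O hO)) =
      F.eval₂ ((T.presheaf.map (homOfLE h).op).hom.comp φ) (coord p hL O' (h.trans hO)) := by
  rw [MvPolynomial.hom_eval₂]
  congr 1
  funext i
  exact coord_res p hL h hO i

/-- A section of the structure sheaf is zero if it is zero locally. -/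
lemma section_eq_zero {X : Scheme.{u}} {U : X.Opens} (s : Γ(X, U))
    (h : ∀ x ∈ U, ∃ (V : X.Opens) (hV : V ≤ U), x ∈ V ∧
      (X.presheaf.map (homOfLE hV).op).hom s = 0) : s = 0 := by
  apply X.IsSheaf.section_ext
  intro x hx
  obtain ⟨V, hV, hxV, hs⟩ := h x hx
  exact ⟨V, hV, hxV, hs.trans (map_zero _).symm⟩

lemma exists_mem_chart (x : PSpace σ k) : ∃ j : σ, x ∈ chart k j := by
  have := Proj.iSup_basicOpen_eq_top' (𝒜 := MvPolynomial.homogeneousSubmodule σ k)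
    (fun j : σ => MvPolynomial.X j) (fun j => ⟨1, MvPolynomial.isHomogeneous_X k j⟩) ?_
  · have h : x ∈ (⊤ : (PSpace σ k).Opens) := trivial
    rw [← this] at h
    simpa using h
  · refine eq_top_iff.mpr fun F _ => ?_
    induction F using MvPolynomial.induction_on with
    | C a =>
      exact Subalgebra.algebraMap_mem (Algebra.adjoin (MvPolynomial.homogeneousSubmodule σ k 0)
        (Set.range fun j : σ => (MvPolynomial.X j : MvPolynomial σ k)))
        ⟨MvPolynomial.C a, MvPolynomial.isHomogeneous_C σ a⟩
    | add F G hF hG => exact add_mem (hF trivial) (hG trivial)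
    | mul_X F j hF => exact mul_mem (hF trivial) (Algebra.subset_adjoin ⟨j, rfl⟩)

/-- On an open set on which the linear form `L` does not vanish, a form `F` vanishes if and only if
`F (x / L) = 0`. -/
lemma formVanishes_iff {L : MvPolynomial σ k} (hL : L.IsHomogeneous 1) {O : T.Opens}
    (hO : O ≤ p ⁻¹ᵁ nonzeroLocus L) {A : Type u} [CommRing A] {φ : A →+* Γ(T, O)} {e : ℕ}
    {F : MvPolynomial σ A} (hF : F.IsHomogeneous e) :
    FormVanishes p O φ F ↔ F.eval₂ φ (coord p hL O hO) = 0 := by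
  have key (j : σ) := eval₂_coord_eq_zero_iff p (MvPolynomial.isHomogeneous_X k j) hL
    (O ⊓ p ⁻¹ᵁ chart k j) inf_le_right (inf_le_left.trans hO)
    ((T.presheaf.map (homOfLE (inf_le_left : O ⊓ p ⁻¹ᵁ chart k j ≤ O)).op).hom.comp φ) hF
  rw [formVanishes_iff_charts]
  refine ⟨fun h => section_eq_zero _ fun x hx => ?_, fun h j => ?_⟩
  · obtain ⟨j, hj⟩ := exists_mem_chart (p x)
    refine ⟨O ⊓ p ⁻¹ᵁ chart k j, inf_le_left, ⟨hx, hj⟩, ?_⟩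
    rw [res_eval₂_coord, ← key j]
    exact h j
  · rw [key j, ← res_eval₂_coord p hL _ hO, h, map_zero]

/-- The vanishing of a form is preserved by base change. -/
lemma FormVanishes.comp {T' : Scheme.{u}} (g : T' ⟶ T) {O : T.Opens} {O' : T'.Opens}
    (h : O' ≤ g ⁻¹ᵁ O) {A : Type u} [CommRing A] {φ : A →+* Γ(T, O)}
    {F : MvPolynomial σ A} (hF : FormVanishes p O φ F) :
    FormVanishes (g ≫ p) O' ((g.appLE O O' h).hom.comp φ) F := by
  rw [formVanishes_iff_charts] at hF ⊢
  intro j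
  have hle : O' ⊓ (g ≫ p) ⁻¹ᵁ chart k j ≤ g ⁻¹ᵁ (O ⊓ p ⁻¹ᵁ chart k j) :=
    fun x hx => ⟨h hx.1, hx.2⟩
  have := congr((g.appLE _ _ hle).hom $(hF j))
  rw [map_zero, MvPolynomial.hom_eval₂] at this
  convert this using 2
  · rw [← RingHom.comp_assoc, ← RingHom.comp_assoc, ← CommRingCat.hom_comp,
      ← CommRingCat.hom_comp, Scheme.Hom.appLE_map, Scheme.Hom.map_appLE]
  · funext i
    exact (coord_comp p g _ hle _ _ i).symm

lemma scalarsOn_top : scalarsOn p ⊤ = scalars (p ≫ PSpace.toSpec σ k) := by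
  have : (homOfLE le_top : (⊤ : T.Opens) ⟶ ⊤).op = 𝟙 _ := rfl
  rw [scalarsOn, this, CategoryTheory.Functor.map_id]
  rfl

lemma VanishesOn.formVanishes_comp {T' : Scheme.{u}} (g : T' ⟶ T) {F : MvPolynomial σ k}
    (hF : VanishesOn p F) (O : T'.Opens) :
    FormVanishes (g ≫ p) O (scalarsOn (g ≫ p) O) F := by
  have := FormVanishes.comp p g (le_preimage_top g O) hF
  rwa [← scalarsOn_top, scalarsOn_comp] at this

lemma VanishesOn.comp {T' : Scheme.{u}} (g : T' ⟶ T) {F : MvPolynomial σ k}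
    (hF : VanishesOn p F) : VanishesOn (g ≫ p) F := by
  have := hF.formVanishes_comp p g ⊤
  rwa [scalarsOn_top] at this

lemma VanishesOn.formVanishes {F : MvPolynomial σ k}
    (hF : VanishesOn p F) (O : T.Opens) : FormVanishes p O (scalarsOn p O) F := by
  have := hF.formVanishes_comp p (𝟙 T) O
  rwa [Category.id_comp] at this

end Coordinates

/-! ### Zero schemes of homogeneous ideals -/

section ZeroSchemes

variable {σ : Type} {k : Type u} [Field k] {T : Scheme.{u}} (p : T ⟶ PSpace σ k)

lemma vanishesOn_iff_charts {F : MvPolynomial σ k} : VanishesOn p F ↔ ∀ j, F.eval₂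
    (scalarsOn p (p ⁻¹ᵁ chart k j))
    (coord p (MvPolynomial.isHomogeneous_X k j) (p ⁻¹ᵁ chart k j) le_rfl) = 0 := by
  rw [VanishesOn, formVanishes_iff_charts]
  refine forall_congr' fun j => ?_
  have (O : T.Opens) (h : O ≤ p ⁻¹ᵁ chart k j) (h' : O = p ⁻¹ᵁ chart k j) :
      F.eval₂ (scalarsOn p O) (coord p (MvPolynomial.isHomogeneous_X k j) O h) = 0 ↔
      F.eval₂ (scalarsOn p (p ⁻¹ᵁ chart k j))
        (coord p (MvPolynomial.isHomogeneous_X k j) (p ⁻¹ᵁ chart k j) le_rfl) = 0 := by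
    subst h'
    rfl
  exact this _ _ (top_inf_eq _)

lemma isAffineOpen_nonzeroLocus {L : MvPolynomial σ k} (hL : L.IsHomogeneous 1) :
    IsAffineOpen (nonzeroLocus L) :=
  Proj.isAffineOpen_basicOpen _ L ((MvPolynomial.mem_homogeneousSubmodule 1 L).mpr hL) one_pos

lemma le_ker_iff_app {X Y : Scheme.{u}} (f : X ⟶ Y) (I : Y.IdealSheafData) :
    I ≤ f.ker ↔ ∀ (U : Y.affineOpens) (s), s ∈ I.ideal U → (f.app U).hom s = 0 :=
  Scheme.IdealSheafData.le_ofIdeals_iff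

/-- Whether a morphism factors through a closed subscheme can be tested locally on its source. -/
lemma le_ker_of_locally {X Y : Scheme.{u}} (f : X ⟶ Y) (I : Y.IdealSheafData)
    (h : ∀ x : X, ∃ V : X.Opens, x ∈ V ∧ I ≤ (V.ι ≫ f).ker) : I ≤ f.ker := by
  rw [le_ker_iff_app]
  intro U s hs
  refine section_eq_zero _ fun x hx => ?_
  obtain ⟨V, hxV, hV⟩ := h x
  have h1 := (le_ker_iff_app _ _).mp hV U s hs
  refine ⟨V.ι ''ᵁ V.ι ⁻¹ᵁ f ⁻¹ᵁ U.1, Set.image_preimage_subset V.ι (f ⁻¹ᵁ U.1),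
    ⟨⟨x, hxV⟩, hx, rfl⟩, ?_⟩
  apply (V.ι.appIso _).commRingCatIsoToRingEquiv.injective
  rw [map_zero, ← RingEquiv.coe_toRingHom, Iso.commRingCatIsoToRingEquiv_toRingHom,
    Scheme.Hom.appIso_hom']
  simp only [homOfLE_leOfHom, Scheme.Hom.app_eq_appLE, ← RingHom.comp_apply,
    ← CommRingCat.hom_comp, Scheme.Hom.appLE_map, Scheme.Hom.appLE_comp_appLE]
  rw [Scheme.Hom.app_eq_appLE] at h1
  exact h1

/-- If a polynomial vanishes on the source of a quasi-compact morphism, then it vanishes on the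
scheme-theoretic image. -/
lemma vanishesOn_image [QuasiCompact p] {F : MvPolynomial σ k}
    (hF : VanishesOn p F) : VanishesOn p.ker.subschemeι F := by
  rw [vanishesOn_iff_charts] at hF ⊢
  intro j
  have hinj : Function.Injective (p.toImage.app (p.ker.subschemeι ⁻¹ᵁ chart k j)).hom :=
    p.toImage_app_injective ⟨_, isAffineOpen_nonzeroLocus (MvPolynomial.isHomogeneous_X k j)⟩
  apply hinj
  have hp : p.toImage ≫ p.ker.subschemeι = p := p.toImage_imageι
  have h1 := Scheme.Hom.app_eq_appLE (f := p.toImage) (U := p.ker.subschemeι ⁻¹ᵁ chart k j)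
  rw [map_zero, h1]
  refine (MvPolynomial.hom_eval₂ _ _ _ _).trans ?_
  trans F.eval₂ (scalarsOn (p.toImage ≫ p.ker.subschemeι)
    ((p.toImage ≫ p.ker.subschemeι) ⁻¹ᵁ chart k j))
    (coord (p.toImage ≫ p.ker.subschemeι) (MvPolynomial.isHomogeneous_X k j)
    ((p.toImage ≫ p.ker.subschemeι) ⁻¹ᵁ chart k j) le_rfl)
  · congr 1
    · exact scalarsOn_comp p.ker.subschemeι p.toImage _
    · funext i
      exact coord_comp p.ker.subschemeι p.toImage _ _ _ _ i
  · have (q : T ⟶ PSpace σ k) (hq : q = p) : F.eval₂ (scalarsOn q (q ⁻¹ᵁ chart k j))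
      (coord q (MvPolynomial.isHomogeneous_X k j) (q ⁻¹ᵁ chart k j) le_rfl) = 0 := by
      subst hq
      exact hF j
    exact this _ hp

/-- If the homogeneous elements of `I` vanish on the source of a morphism to projective space, then
the morphism factors through the zero scheme of `I`. -/
lemma zeroScheme_le_ker {I : Ideal (MvPolynomial σ k)}
    (h : ∀ (e : ℕ) (F : MvPolynomial σ k), F ∈ I → F.IsHomogeneous e → VanishesOn p F) :
    zeroScheme I ≤ p.ker := by
  refine le_ker_of_locally _ _ fun x => ?_
  obtain ⟨_, ⟨(V : T.Opens), hV, rfl⟩, hxV, -⟩ :=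
    T.isBasis_affineOpens.exists_subset_of_mem_open (Set.mem_univ x) isOpen_univ
  refine ⟨V, hxV, sInf_le fun e F hF he => ?_⟩
  have : IsAffine V := hV
  have : (PSpace σ k).IsSeparated := inferInstance
  exact vanishesOn_image _ ((h e F hF he).comp p V.ι)

lemma isAffineOpen_chart (j : σ) : IsAffineOpen (chart k j) :=
  isAffineOpen_nonzeroLocus (MvPolynomial.isHomogeneous_X k j)

lemma eval₂_coord_self {F : MvPolynomial σ k} {e : ℕ} (hF : F.IsHomogeneous e) (j : σ) :
    F.eval₂ (scalarsOn p (p ⁻¹ᵁ chart k j))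
      (coord p (MvPolynomial.isHomogeneous_X k j) (p ⁻¹ᵁ chart k j) le_rfl) =
    (p.app (chart k j)).hom (fraction (MvPolynomial.isHomogeneous_X k j) hF) := by
  rw [eval₂_coord p _ _ _ hF, Scheme.Hom.app_eq_appLE]

lemma vanishesOn_iff_app {F : MvPolynomial σ k} {e : ℕ} (hF : F.IsHomogeneous e) :
    VanishesOn p F ↔ ∀ j,
      (p.app (chart k j)).hom (fraction (MvPolynomial.isHomogeneous_X k j) hF) = 0 := by
  simp_rw [vanishesOn_iff_charts, eval₂_coord_self p hF]

lemma vanishesOn_subschemeι_iff (J : (PSpace σ k).IdealSheafData) {F : MvPolynomial σ k} {e : ℕ}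
    (hF : F.IsHomogeneous e) : VanishesOn J.subschemeι F ↔ ∀ j,
      fraction (MvPolynomial.isHomogeneous_X k j) hF ∈
        J.ideal ⟨chart k j, isAffineOpen_chart j⟩ := by
  rw [vanishesOn_iff_app _ hF]
  refine forall_congr' fun j => ?_
  rw [← RingHom.mem_ker, ← J.ker_subschemeι_app ⟨chart k j, isAffineOpen_chart j⟩]

/-- The ideal of the dehomogenizations at `x_j` of the homogeneous elements of `I`. -/
def chartIdeal (I : Ideal (MvPolynomial σ k)) (j : σ) : Ideal Γ(PSpace σ k, chart k j) :=
  Ideal.span {s | ∃ (e : ℕ) (F : MvPolynomial σ k) (he : F.IsHomogeneous e), F ∈ I ∧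
    s = fraction (MvPolynomial.isHomogeneous_X k j) he}

/-- The inclusion in projective space of the zero scheme of `I` in a standard chart. -/
def chartZeros (I : Ideal (MvPolynomial σ k)) (j : σ) :
    Spec (.of (Γ(PSpace σ k, chart k j) ⧸ chartIdeal I j)) ⟶ PSpace σ k :=
  Spec.map (CommRingCat.ofHom (Ideal.Quotient.mk (chartIdeal I j))) ≫
    (isAffineOpen_chart j).fromSpec

lemma chartZeros_le (I : Ideal (MvPolynomial σ k)) (j : σ) :
    ⊤ ≤ chartZeros I j ⁻¹ᵁ chart k j := by
  intro x _
  have h : (chartZeros I j) x ∈ Set.range (isAffineOpen_chart j).fromSpec := by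
    rw [chartZeros, Scheme.Hom.comp_apply]
    exact ⟨_, rfl⟩
  rw [IsAffineOpen.range_fromSpec] at h
  exact h

lemma chartZeros_appLE (I : Ideal (MvPolynomial σ k)) (j : σ) {s : Γ(PSpace σ k, chart k j)}
    (hs : s ∈ chartIdeal I j) :
    ((chartZeros I j).appLE (chart k j) ⊤ (chartZeros_le I j)).hom s = 0 := by
  have hU := isAffineOpen_chart (k := k) j
  have h2 : (⊤ : (Spec Γ(PSpace σ k, chart k j)).Opens) ≤ hU.fromSpec ⁻¹ᵁ chart k j :=
    hU.fromSpec_preimage_self.ge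
  have h1 : hU.fromSpec.appLE (chart k j) ⊤ h2 = (Scheme.ΓSpecIso _).inv := by
    rw [Scheme.Hom.appLE, hU.fromSpec_app_self, Category.assoc, ← Functor.map_comp]
    exact (congrArg _ (CategoryTheory.Functor.map_id _ _)).trans (Category.comp_id _)
  have h3 : (chartZeros I j).appLE (chart k j) ⊤ (chartZeros_le I j) =
      CommRingCat.ofHom (Ideal.Quotient.mk (chartIdeal I j)) ≫ (Scheme.ΓSpecIso _).inv := by
    refine Eq.trans ?_ (Scheme.ΓSpecIso_inv_naturality _).symm
    rw [← h1]
    have := Scheme.Hom.appLE_comp_appLE (Spec.map (CommRingCat.ofHom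
      (Ideal.Quotient.mk (chartIdeal I j)))) hU.fromSpec (chart k j) ⊤ ⊤ h2 (le_preimage_top _ _)
    refine this.symm.trans ?_
    congr 1
  rw [h3]
  have : Ideal.Quotient.mk (chartIdeal I j) s = 0 := Ideal.Quotient.eq_zero_iff_mem.mpr hs
  exact (congrArg (Scheme.ΓSpecIso _).inv.hom this).trans (map_zero _)

lemma vanishesOn_chartZeros {I : Ideal (MvPolynomial σ k)} (j : σ) {e : ℕ}
    {F : MvPolynomial σ k} (hF : F ∈ I) (he : F.IsHomogeneous e) :
    VanishesOn (chartZeros I j) F := by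
  rw [VanishesOn, formVanishes_iff _ (MvPolynomial.isHomogeneous_X k j) (chartZeros_le I j) he,
    ← scalarsOn_top, eval₂_coord _ _ _ _ he]
  exact chartZeros_appLE I j (Ideal.subset_span ⟨e, F, he, hF, rfl⟩)

/-- A morphism to projective space on which the homogeneous elements of `I` vanish factors through
the zeros of `I` in the chart over the affine open sets that it maps to the chart. -/
lemma chartZeros_ker_le {I : Ideal (MvPolynomial σ k)} (j : σ)
    (h : ∀ (e : ℕ) (F : MvPolynomial σ k), F ∈ I → F.IsHomogeneous e → VanishesOn p F)
    {V : T.Opens} (hV : IsAffineOpen V) (hVj : V ≤ p ⁻¹ᵁ chart k j) :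
    (chartZeros I j).ker ≤ (V.ι ≫ p).ker := by
  have hle : chartIdeal I j ≤ RingHom.ker (p.appLE (chart k j) V hVj).hom := by
    refine Ideal.span_le.mpr ?_
    rintro _ ⟨e, F, he, hF, rfl⟩
    have := h e F hF he
    rw [vanishesOn_iff_app p he] at this
    exact (congrArg (T.presheaf.map (homOfLE hVj).op).hom (this j)).trans (map_zero _)
  have h1 : p.appLE (chart k j) V hVj = CommRingCat.ofHom (Ideal.Quotient.mk (chartIdeal I j)) ≫
      CommRingCat.ofHom (Ideal.Quotient.lift _ _ hle) := by
    ext x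
    rfl
  have h2 := IsAffineOpen.SpecMap_appLE_fromSpec p (isAffineOpen_chart j) hV hVj
  have h3 : V.ι ≫ p = (hV.isoSpec.hom ≫ Spec.map (CommRingCat.ofHom
      (Ideal.Quotient.lift _ _ hle))) ≫ chartZeros I j := by
    rw [← hV.isoSpec_hom_fromSpec, Category.assoc, ← h2, Category.assoc, chartZeros]
    refine congrArg (hV.isoSpec.hom ≫ ·) ?_
    rw [← Spec.map_comp_assoc, ← h1]
  rw [h3]
  exact Scheme.Hom.le_ker_comp _ _

/-- The homogeneous elements of `I` vanish on the zero scheme of `I`. The zero scheme is defined by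
an infimum of ideal sheaves, and it is not formal that vanishing passes to it: its ideal sheaf
contains the intersection of the kernels of the inclusions of the zeros of `I` in the standard
charts, and a form vanishes on each of these. -/
lemma vanishesOn_zeroScheme [Finite σ] {I : Ideal (MvPolynomial σ k)} {e : ℕ}
    {F : MvPolynomial σ k} (hF : F ∈ I) (he : F.IsHomogeneous e) :
    VanishesOn (zeroScheme I).subschemeι F := by
  have hle : ⨅ j, (chartZeros I j).ker ≤ zeroScheme I := by
    refine le_sInf fun J hJ => ?_
    rw [← J.ker_subschemeι]
    refine le_ker_of_locally _ _ fun x => ?_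
    obtain ⟨j, hj⟩ := exists_mem_chart (J.subschemeι x)
    obtain ⟨_, ⟨(V : J.subscheme.Opens), hV, rfl⟩, hxV, hVj⟩ :=
      J.subscheme.isBasis_affineOpens.exists_subset_of_mem_open
        (show x ∈ (J.subschemeι ⁻¹ᵁ chart k j : Set J.subscheme) from hj)
        (J.subschemeι ⁻¹ᵁ chart k j).isOpen
    exact ⟨V, hxV, (iInf_le _ j).trans (chartZeros_ker_le _ j hJ hV hVj)⟩
  rw [vanishesOn_subschemeι_iff _ he]
  intro l
  refine hle _ ?_
  rw [Scheme.IdealSheafData.ideal_iInf, iInf_apply]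
  refine Ideal.mem_iInf.mpr fun j => ?_
  rw [Scheme.Hom.ker_apply, RingHom.mem_ker]
  exact (vanishesOn_iff_app _ he).mp (vanishesOn_chartZeros j hF he) l

end ZeroSchemes

/-! ### Finite algebras spanned by monomials -/

section FiniteAlgebras

variable {k D τ : Type*} [Field k] [CommRing D] [Algebra k D] [Module.Finite k D]

/-- The powers of a space of generators that contains `1` grow strictly until they exhaust a finite
algebra. -/
lemma span_pow_eq_top_or_lt_finrank (E : Submodule k D) (h1 : 1 ∈ E)
    (hgen : Algebra.adjoin k (E : Set D) = ⊤) (i : ℕ) :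
    E ^ i = ⊤ ∨ i + 1 ≤ Module.finrank k ↥(E ^ i) := by
  induction i with
  | zero =>
    by_cases hD : (1 : Submodule k D) = ⊤
    · exact Or.inl (by rwa [pow_zero])
    · right
      rw [pow_zero, zero_add, Nat.one_le_iff_ne_zero, Ne, Submodule.finrank_eq_zero]
      intro h
      have h10 : (1 : D) ∈ (1 : Submodule k D) := Submodule.one_le.mp le_rfl
      rw [h, Submodule.mem_bot] at h10
      have := subsingleton_of_zero_eq_one h10.symm
      exact hD (Subsingleton.elim _ _)
  | succ i ih =>
    have hle : E ^ i ≤ E ^ (i + 1) := by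
      rw [pow_succ]
      exact fun x hx => by simpa using Submodule.mul_mem_mul hx h1
    rcases ih with h | h
    · exact Or.inl (top_le_iff.mp (h ▸ hle))
    · by_cases heq : E ^ i = E ^ (i + 1)
      · -- a space that contains `1` and is stable under the generators is everything
        left
        rw [← heq, ← top_le_iff]
        have hstab : ∀ a ∈ Algebra.adjoin k (E : Set D), ∀ x ∈ E ^ i, a * x ∈ E ^ i := by
          intro a ha
          induction ha using Algebra.adjoin_induction with
          | mem a ha =>
            intro x hx
            rw [heq, pow_succ']
            exact Submodule.mul_mem_mul ha hx
          | algebraMap c =>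
            intro x hx
            rw [← Algebra.smul_def]
            exact Submodule.smul_mem _ _ hx
          | add a b _ _ ha hb =>
            intro x hx
            rw [add_mul]
            exact add_mem (ha x hx) (hb x hx)
          | mul a b _ _ ha hb =>
            intro x hx
            rw [mul_assoc]
            exact ha _ (hb x hx)
        intro a _
        have := hstab a (by rw [hgen]; trivial) (1 ^ i) (Submodule.pow_mem_pow _ h1 i)
        simpa using this
      · exact Or.inr (h.trans_lt (Submodule.finrank_lt_finrank_of_lt (lt_of_le_of_ne hle heq)))

lemma span_pow_eq_top (E : Submodule k D) (h1 : 1 ∈ E)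
    (hgen : Algebra.adjoin k (E : Set D) = ⊤) {i : ℕ} (hi : Module.finrank k D ≤ i + 1) :
    E ^ i = ⊤ := by
  refine (span_pow_eq_top_or_lt_finrank E h1 hgen i).elim id fun h => ?_
  exact Submodule.eq_top_of_finrank_eq ((Submodule.finrank_le _).antisymm (hi.trans h))

/-- A finite algebra of dimension at most `i + 1`, generated by elements `y_l` of which `1` is a
linear combination, is spanned by the monomials of degree `i` in the `y_l`. -/
lemma span_monomials_eq_top {n i : ℕ} (y : Fin (n + 1) → D)
    (h1 : 1 ∈ Submodule.span k (Set.range y)) (hgen : Algebra.adjoin k (Set.range y) = ⊤)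
    (hi : Module.finrank k D ≤ i + 1) :
    Submodule.span k (Set.range fun m : Mon n i => MvPolynomial.aeval y
      (MvPolynomial.monomial m.1 (1 : k))) = ⊤ := by
  have h2 := span_pow_eq_top (Submodule.span k (Set.range y)) h1
    (by rw [Algebra.adjoin_span, hgen]) hi
  rw [← top_le_iff, ← h2]
  have h3 : Submodule.span k (Set.range y) = Submodule.map
      (MvPolynomial.aeval y : MvPolynomial (Fin (n + 1)) k →ₐ[k] D).toLinearMap
      (MvPolynomial.homogeneousSubmodule _ k 1) := by
    rw [MvPolynomial.homogeneousSubmodule_one_eq_span_X, Submodule.map_span, ← Set.range_comp]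
    congr 2
    funext l
    simp
  rw [h3, ← Submodule.map_pow, MvPolynomial.homogeneousSubmodule_one_pow]
  rintro _ ⟨F, hF, rfl⟩
  rw [AlgHom.toLinearMap_apply, F.as_sum, map_sum]
  refine sum_mem fun m hm => ?_
  have hdeg : m.degree = i := by
    rw [Finsupp.degree_eq_weight_one]
    exact hF (MvPolynomial.mem_support_iff.mp hm)
  have : MvPolynomial.monomial m (F.coeff m) = F.coeff m • MvPolynomial.monomial m (1 : k) := by
    rw [MvPolynomial.smul_monomial, smul_eq_mul, mul_one]
  rw [this, map_smul]
  exact Submodule.smul_mem _ _ (Submodule.subset_span ⟨⟨m, hdeg⟩, rfl⟩)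

lemma exists_spanning_subfamily {ι : Type*} (v : ι → D)
    (hv : Submodule.span k (Set.range v) = ⊤) : ∃ s : Fin (Module.finrank k D) → ι,
      Submodule.span k (Set.range (v ∘ s)) = ⊤ := by
  obtain ⟨f, hf, hspan, -⟩ := Submodule.exists_fun_fin_finrank_span_eq k (Set.range v)
  have hrk : Module.finrank k D = Module.finrank k ↥(Submodule.span k (Set.range v)) := by
    rw [hv, finrank_top]
  choose g hg using hf
  refine ⟨g ∘ finCongr hrk, ?_⟩
  rw [← Function.comp_assoc, (finCongr hrk).surjective.range_comp, show v ∘ g = f from funext hg,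
    hspan, hv]

end FiniteAlgebras

/-! ### Generators of a finite algebra near a rational point -/

/-- **Nakayama's lemma** in geometric form: elements of a finite `A`-algebra `B` that span the fibre
`B ⊗ K` over a rational point generate `B` after inverting a function that is `1` at the point. -/
lemma exists_smul_mem_span {A B D K : CommRingCat.{u}} {α : A ⟶ B} {π : A ⟶ K} {φ : B ⟶ D}
    {ψ : K ⟶ D} (h : IsPushout α π φ ψ) (s : K ⟶ A) (hs : s ≫ π = 𝟙 K) (hα : α.hom.Finite)
    {ι : Type*} [Fintype ι] (b : ι → B)
    (hb : ∀ x : D, ∃ c : ι → K, x = ∑ l, ψ.hom (c l) * φ.hom (b l)) :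
    ∃ f : A, π.hom f = 1 ∧ ∀ z : B, ∃ c : ι → A, α.hom f * z = ∑ l, α.hom (c l) * b l := by
  algebraize [α.hom]
  let I : Ideal A := RingHom.ker π.hom
  have hsπ (c : K) : π.hom (s.hom c) = c := congr($(hs).hom c)
  -- the kernel of `B ⟶ D` is generated by `I`, by the universal property of the pushout
  have hker (z : B) (hz : φ.hom z = 0) : z ∈ I • (⊤ : Submodule A B) := by
    let q : B →+* B ⧸ I.map α.hom := Ideal.Quotient.mk _
    have hw : α ≫ CommRingCat.ofHom q = π ≫ s ≫ α ≫ CommRingCat.ofHom q := by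
      ext a
      change Ideal.Quotient.mk _ (α.hom a) = Ideal.Quotient.mk _ (α.hom (s.hom (π.hom a)))
      rw [Ideal.Quotient.eq, ← map_sub]
      refine Ideal.mem_map_of_mem _ ?_
      rw [RingHom.mem_ker, map_sub, hsπ, sub_self]
    have h2 := congr($(h.inl_desc _ _ hw).hom z)
    rw [CommRingCat.hom_comp, RingHom.comp_apply, hz, map_zero] at h2
    have h3 : z ∈ I.map α.hom := Ideal.Quotient.eq_zero_iff_mem.mp h2.symm
    rw [Ideal.smul_top_eq_map]
    exact h3
  have hle : (⊤ : Submodule A B) ≤ Submodule.span A (Set.range b) ⊔ I • ⊤ := by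
    intro z _
    obtain ⟨c, hc⟩ := hb (φ.hom z)
    have hφ (a : A) : φ.hom (α.hom a) = ψ.hom (π.hom a) := congr($(h.w).hom a)
    have : z = (∑ l, s.hom (c l) • b l) + (z - ∑ l, s.hom (c l) • b l) := by ring
    rw [this]
    refine Submodule.add_mem_sup (sum_mem fun l _ => Submodule.smul_mem _ _
      (Submodule.subset_span ⟨l, rfl⟩)) (hker _ ?_)
    rw [map_sub, hc, map_sum, sub_eq_zero]
    refine Finset.sum_congr rfl fun l _ => ?_
    rw [Algebra.smul_def, map_mul, RingHom.algebraMap_toAlgebra, hφ, hsπ]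
  have hfin : Module.Finite A B := hα
  obtain ⟨f, hf, hfB⟩ := Submodule.exists_sub_one_mem_and_smul_le_of_fg_of_le_sup
    hfin.fg_top le_rfl hle
  refine ⟨f, ?_, fun z => ?_⟩
  · rw [RingHom.mem_ker, map_sub, map_one, sub_eq_zero] at hf
    exact hf
  · have := hfB (Submodule.smul_mem_pointwise_smul z f ⊤ trivial)
    obtain ⟨c, hc⟩ := (Submodule.mem_span_range_iff_exists_fun A).mp this
    exact ⟨c, by simpa [Algebra.smul_def, RingHom.algebraMap_toAlgebra] using hc.symm⟩

/-! ### Equations of the Veronese variety -/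

section Veronese

variable {k : Type u} [Field k] {n d : ℕ}

/-- The substitution `z_m ↦ m` of the monomials of degree `d` for the coordinates. -/
def veroneseMap (k : Type u) [Field k] (n d : ℕ) :
    MvPolynomial (Mon n d) k →ₐ[k] MvPolynomial (Fin (n + 1)) k :=
  MvPolynomial.aeval fun m : Mon n d => MvPolynomial.monomial m.1 (1 : k)

lemma mem_veroneseIdeal {F : MvPolynomial (Mon n d) k} :
    F ∈ veroneseIdeal k n d ↔ veroneseMap k n d F = 0 := Iff.rfl

/-- The linear form in the coordinates `z_m` that a form `P` of degree `d` represents. -/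
def linForm (d : ℕ) : MvPolynomial (Fin (n + 1)) k →ₗ[k] MvPolynomial (Mon n d) k where
  toFun P := ∑ m : Mon n d, P.coeff m.1 • MvPolynomial.X m
  map_add' P Q := by simp_rw [MvPolynomial.coeff_add, add_smul, Finset.sum_add_distrib]
  map_smul' c P := by
    simp_rw [MvPolynomial.coeff_smul, Finset.smul_sum, smul_smul, smul_eq_mul, RingHom.id_apply]

lemma linForm_isHomogeneous (P : MvPolynomial (Fin (n + 1)) k) :
    (linForm d P).IsHomogeneous 1 :=
  (MvPolynomial.homogeneousSubmodule (Mon n d) k 1).sum_mem fun m _ =>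
    Submodule.smul_mem _ _ (MvPolynomial.isHomogeneous_X k m)

lemma linForm_monomial (m : Mon n d) :
    linForm d (MvPolynomial.monomial m.1 (1 : k)) = MvPolynomial.X m := by
  classical
  change ∑ m' : Mon n d, _ = _
  rw [Finset.sum_eq_single m]
  · simp
  · intro m' _ hm'
    rw [MvPolynomial.coeff_monomial, if_neg (fun h => hm' (Subtype.ext h.symm)), zero_smul]
  · simp

lemma veroneseMap_linForm {P : MvPolynomial (Fin (n + 1)) k} (hP : P.IsHomogeneous d) :
    veroneseMap k n d (linForm d P) = P := by
  have h (m : Fin (n + 1) →₀ ℕ) (hm : m ∈ P.support) : m.degree = d := by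
    rw [Finsupp.degree_eq_weight_one]
    exact hP (MvPolynomial.mem_support_iff.mp hm)
  have h2 : P = ∑ m ∈ P.support, P.coeff m • MvPolynomial.monomial m (1 : k) := by
    refine P.as_sum.trans (Finset.sum_congr rfl fun m _ => ?_)
    rw [MvPolynomial.smul_monomial, smul_eq_mul, mul_one]
  conv_lhs => rw [h2]
  conv_rhs => rw [h2]
  rw [map_sum, map_sum]
  refine Finset.sum_congr rfl fun m hm => ?_
  rw [map_smul, map_smul, linForm_monomial ⟨m, h m hm⟩, veroneseMap, MvPolynomial.aeval_X]

/-- The linear form on `V` with coefficients `h`. -/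
def linearForm : (Fin (n + 1) → k) →ₗ[k] MvPolynomial (Fin (n + 1)) k :=
  Fintype.linearCombination k MvPolynomial.X

lemma linearForm_apply (h : Fin (n + 1) → k) : linearForm h = ∑ l, h l • MvPolynomial.X l :=
  Fintype.linearCombination_apply k _ _

lemma linearForm_single (j : Fin (n + 1)) :
    linearForm (Pi.single j (1 : k)) = MvPolynomial.X j := by
  rw [linearForm, Fintype.linearCombination_apply_single, one_smul]

lemma linearForm_isHomogeneous (h : Fin (n + 1) → k) : (linearForm h).IsHomogeneous 1 := by
  rw [linearForm_apply]
  exact (MvPolynomial.homogeneousSubmodule (Fin (n + 1)) k 1).sum_mem fun l _ =>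
    Submodule.smul_mem _ _ (MvPolynomial.isHomogeneous_X k l)

lemma isHomogeneous_mul_pow {P h : MvPolynomial (Fin (n + 1)) k} (hP : P.IsHomogeneous 1)
    (hh : h.IsHomogeneous 1) (hd : 1 ≤ d) : (P * h ^ (d - 1)).IsHomogeneous d := by
  have := hP.mul (hh.pow (d - 1))
  rwa [one_mul, Nat.add_sub_cancel' hd] at this

/-- The exponent of the monomial `α_j ^ d`. -/
def powMon (d : ℕ) (j : Fin (n + 1)) : Mon n d :=
  ⟨Finsupp.single j d, Finsupp.degree_single j d⟩

lemma linForm_pow_X (j : Fin (n + 1)) :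
    linForm d (MvPolynomial.X j ^ d : MvPolynomial (Fin (n + 1)) k) =
      MvPolynomial.X (powMon d j) := by
  rw [← linForm_monomial, MvPolynomial.X_pow_eq_monomial]
  rfl

lemma prod_pow_isHomogeneous {τ : Type*} {A : Type*} [CommRing A]
    {ι : Type*} [Fintype ι] (y : ι → MvPolynomial τ A) (hy : ∀ l, (y l).IsHomogeneous 1)
    (m : ι →₀ ℕ) : (∏ l, y l ^ m l).IsHomogeneous m.degree := by
  rw [Finsupp.degree_eq_sum]
  exact MvPolynomial.IsHomogeneous.prod _ _ _ fun l _ => by simpa using (hy l).pow (m l)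

/-- The equation `z_m (h^d)^(d - 1) = ∏ (α_l h^(d - 1))^(m_l)` of the Veronese variety. -/
lemma monomial_relation_mem (hd : 1 ≤ d) {h : MvPolynomial (Fin (n + 1)) k}
    (hh : h.IsHomogeneous 1) (m : Mon n d) :
    MvPolynomial.X m * linForm d (h ^ d) ^ (d - 1) -
      ∏ l, linForm d (MvPolynomial.X l * h ^ (d - 1)) ^ m.1 l ∈ veroneseIdeal k n d := by
  rw [mem_veroneseIdeal, map_sub, map_mul, map_pow, map_prod, veroneseMap_linForm (by
    simpa using hh.pow d), sub_eq_zero]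
  simp_rw [map_pow, veroneseMap_linForm (isHomogeneous_mul_pow (MvPolynomial.isHomogeneous_X k _)
    hh hd), mul_pow, Finset.prod_mul_distrib, Finset.prod_pow_eq_pow_sum]
  rw [← pow_mul, ← pow_mul, ← Finsupp.degree_eq_sum, m.2, mul_comm d]
  congr 1
  rw [veroneseMap, MvPolynomial.aeval_X, MvPolynomial.monomial_eq, map_one, one_mul,
    Finsupp.prod_fintype _ _ (by simp)]

lemma monomial_relation_isHomogeneous (hd : 1 ≤ d) (h : MvPolynomial (Fin (n + 1)) k)
    (m : Mon n d) :
    (MvPolynomial.X m * linForm d (h ^ d) ^ (d - 1) -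
      ∏ l, linForm d (MvPolynomial.X l * h ^ (d - 1)) ^ m.1 l).IsHomogeneous d := by
  refine MvPolynomial.IsHomogeneous.sub ?_ ?_
  · have := (MvPolynomial.isHomogeneous_X k m).mul
      ((linForm_isHomogeneous (d := d) (h ^ d)).pow (d - 1))
    rwa [one_mul, Nat.add_sub_cancel' hd] at this
  · have := prod_pow_isHomogeneous (fun l => linForm d (MvPolynomial.X l * h ^ (d - 1)))
      (fun l => linForm_isHomogeneous _) m.1
    rwa [m.2] at this

/-- At a point of the Veronese variety some coordinate `z_m`, for `m` a pure power, is not zero. -/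
lemma exists_powMon_notMem (hd : 1 ≤ d) (P : Ideal (MvPolynomial (Mon n d) k)) [P.IsPrime]
    (hP : ∀ (e : ℕ) (F : MvPolynomial (Mon n d) k), F ∈ veroneseIdeal k n d → F.IsHomogeneous e →
      F ∈ P) (hX : ∃ m : Mon n d, MvPolynomial.X m ∉ P) :
    ∃ j : Fin (n + 1), MvPolynomial.X (powMon d j) ∉ P := by
  by_contra! hall
  obtain ⟨m, hm⟩ := hX
  have hmem : MvPolynomial.X m ^ d - ∏ l, MvPolynomial.X (powMon d l) ^ m.1 l ∈
      veroneseIdeal k n d := by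
    rw [mem_veroneseIdeal, map_sub, map_pow, map_prod, sub_eq_zero]
    simp_rw [map_pow, veroneseMap, MvPolynomial.aeval_X, powMon,
      ← MvPolynomial.X_pow_eq_monomial, MvPolynomial.monomial_eq, map_one, one_mul,
      Finsupp.prod_fintype _ _ (fun _ => pow_zero _), ← Finset.prod_pow, ← pow_mul, mul_comm]
  have hhom : (MvPolynomial.X m ^ d - ∏ l, MvPolynomial.X (powMon d l) ^ m.1 l :
      MvPolynomial (Mon n d) k).IsHomogeneous d := by
    refine MvPolynomial.IsHomogeneous.sub ?_ ?_
    · simpa using (MvPolynomial.isHomogeneous_X k m).pow d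
    · have := prod_pow_isHomogeneous (fun l => (MvPolynomial.X (powMon d l) :
        MvPolynomial (Mon n d) k)) (fun l => MvPolynomial.isHomogeneous_X k _) m.1
      rwa [m.2] at this
  obtain ⟨l, hl⟩ : ∃ l, m.1 l ≠ 0 := by
    by_contra! h0
    have h1 := m.2
    rw [Finsupp.degree_eq_sum, Finset.sum_eq_zero fun l _ => h0 l] at h1
    omega
  have hprod : ∏ l, MvPolynomial.X (powMon d l) ^ m.1 l ∈ P :=
    Ideal.mem_of_dvd _ (Finset.dvd_prod_of_mem _ (Finset.mem_univ l))
      (Ideal.pow_mem_of_mem _ (hall l) _ (Nat.pos_of_ne_zero hl))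
  exact hm (Ideal.IsPrime.mem_of_pow_mem inferInstance d
    (by simpa using add_mem (hP d _ hmem hhom) hprod))

/-- The equation `(h^d) (α_j^d)^(d - 1) = (h α_j^(d - 1))^d` of the Veronese variety. -/
lemma power_relation_mem (hd : 1 ≤ d) {h : MvPolynomial (Fin (n + 1)) k}
    (hh : h.IsHomogeneous 1) (j : Fin (n + 1)) :
    linForm d (h ^ d) * MvPolynomial.X (powMon d j) ^ (d - 1) -
      linForm d (h * MvPolynomial.X j ^ (d - 1)) ^ d ∈ veroneseIdeal k n d := by
  rw [mem_veroneseIdeal, ← linForm_pow_X, map_sub, map_mul, map_pow (veroneseMap k n d),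
    map_pow (veroneseMap k n d), veroneseMap_linForm (by simpa using hh.pow d),
    veroneseMap_linForm (by simpa using (MvPolynomial.isHomogeneous_X k j).pow d),
    veroneseMap_linForm (isHomogeneous_mul_pow hh (MvPolynomial.isHomogeneous_X k j) hd),
    mul_pow, ← pow_mul, ← pow_mul, mul_comm d, sub_self]

lemma power_relation_isHomogeneous (hd : 1 ≤ d) (h : MvPolynomial (Fin (n + 1)) k)
    (j : Fin (n + 1)) :
    (linForm d (h ^ d) * MvPolynomial.X (powMon d j) ^ (d - 1) -
      linForm d (h * MvPolynomial.X j ^ (d - 1)) ^ d).IsHomogeneous d := by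
  refine MvPolynomial.IsHomogeneous.sub ?_ ?_
  · have := (linForm_isHomogeneous (d := d) (h ^ d)).mul
      ((MvPolynomial.isHomogeneous_X k (powMon d j)).pow (d - 1))
    rwa [one_mul, Nat.add_sub_cancel' hd] at this
  · simpa using (linForm_isHomogeneous (d := d) (h * MvPolynomial.X j ^ (d - 1))).pow d

/-- At a point of the Veronese variety, `h ^ d` does not vanish if `h` avoids a proper linear
subspace of the space of linear forms. -/
lemma exists_subspace_avoiding (hd : 1 ≤ d) (P : Ideal (MvPolynomial (Mon n d) k)) [P.IsPrime]
    (hP : ∀ (e : ℕ) (F : MvPolynomial (Mon n d) k), F ∈ veroneseIdeal k n d → F.IsHomogeneous e →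
      F ∈ P) (hX : ∃ m : Mon n d, MvPolynomial.X m ∉ P) :
    ∃ H : Submodule k (Fin (n + 1) → k), H ≠ ⊤ ∧
      ∀ h ∉ H, linForm d (linearForm h ^ d) ∉ P := by
  obtain ⟨j, hj⟩ := exists_powMon_notMem hd P hP hX
  have hsmul (c : k) (x : MvPolynomial (Mon n d) k) (hx : x ∈ P) : c • x ∈ P := by
    rw [MvPolynomial.smul_eq_C_mul]
    exact P.mul_mem_left _ hx
  let H : Submodule k (Fin (n + 1) → k) :=
    { carrier := {h | linForm d (linearForm h * MvPolynomial.X j ^ (d - 1)) ∈ P}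
      add_mem' := fun {a b} ha hb => by
        rw [Set.mem_ofPred_eq, map_add, add_mul, map_add]
        exact P.add_mem ha hb
      zero_mem' := by
        rw [Set.mem_ofPred_eq, map_zero, zero_mul, map_zero]
        exact P.zero_mem
      smul_mem' := fun c x hx => by
        rw [Set.mem_ofPred_eq, map_smul, smul_mul_assoc, map_smul]
        exact hsmul c _ hx }
  refine ⟨H, fun htop => ?_, fun h hh hmem => hh ?_⟩
  · have h0 : Pi.single j 1 ∈ H := by rw [htop]; trivial
    change linForm d (linearForm (Pi.single j 1) * MvPolynomial.X j ^ (d - 1)) ∈ P at h0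
    rw [linearForm_single, ← pow_succ', Nat.sub_add_cancel hd, linForm_pow_X] at h0
    exact hj h0
  · change linForm d (linearForm h * MvPolynomial.X j ^ (d - 1)) ∈ P
    have h2 := P.sub_mem (P.mul_mem_right (MvPolynomial.X (powMon d j) ^ (d - 1)) hmem)
      (hP d _ (power_relation_mem hd (linearForm_isHomogeneous h) j)
        (power_relation_isHomogeneous hd _ j))
    rw [sub_sub_cancel] at h2
    exact Ideal.IsPrime.mem_of_pow_mem inferInstance d h2

/-- Finitely many points of the Veronese variety avoid a common hyperplane of the form
`h ^ d = 0`. -/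
lemma exists_linearForm_avoiding [Infinite k] (hd : 1 ≤ d) {ι : Type*} [Finite ι]
    (P : ι → Ideal (MvPolynomial (Mon n d) k)) [∀ x, (P x).IsPrime]
    (hP : ∀ x (e : ℕ) (F : MvPolynomial (Mon n d) k), F ∈ veroneseIdeal k n d →
      F.IsHomogeneous e → F ∈ P x) (hX : ∀ x, ∃ m : Mon n d, MvPolynomial.X m ∉ P x) :
    ∃ h : Fin (n + 1) → k, ∀ x, linForm d (linearForm h ^ d) ∉ P x := by
  choose H hH hav using fun x => exists_subspace_avoiding hd (P x) (hP x) (hX x)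
  by_contra! hcon
  obtain ⟨x, hx⟩ := Subspace.exists_eq_top_of_iUnion_eq_univ (p := H) (by
    refine Set.eq_univ_of_forall fun h => Set.mem_iUnion.mpr ?_
    obtain ⟨x, hx⟩ := hcon h
    exact ⟨x, by_contra fun hn => hav x h hn hx⟩)
  exact hH x hx

/-- On the part of the Veronese variety where `h ^ d` does not vanish, the coordinates
`z_m / h ^ d` are the monomials in the `y_l = α_l h ^ (d - 1) / h ^ d`. -/
lemma eval₂_coordinates_eq_monomial {B : Type*} [CommRing B] (φ : k →+* B) (t : Mon n d → B)
    (hd : 1 ≤ d) {h : MvPolynomial (Fin (n + 1)) k} (hh : h.IsHomogeneous 1)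
    (ht : ∀ (e : ℕ) (F : MvPolynomial (Mon n d) k), F ∈ veroneseIdeal k n d → F.IsHomogeneous e →
      F.eval₂ φ t = 0) (h1 : (linForm d (h ^ d)).eval₂ φ t = 1) (m : Mon n d) :
    t m = ∏ l, (linForm d (MvPolynomial.X l * h ^ (d - 1))).eval₂ φ t ^ m.1 l := by
  have := ht d _ (monomial_relation_mem hd hh m) (monomial_relation_isHomogeneous hd h m)
  rw [← MvPolynomial.coe_eval₂Hom, map_sub, map_mul, map_pow, map_prod, sub_eq_zero] at this
  simp_rw [map_pow, MvPolynomial.coe_eval₂Hom, h1, one_pow, mul_one, MvPolynomial.eval₂_X] at this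
  exact this

end Veronese

/-! ### Points and functions of schemes over projective space -/

section Points

variable {σ : Type} {k : Type u} [Field k] {T : Scheme.{u}} (p : T ⟶ PSpace σ k)

/-- A form that vanishes on a scheme over projective space lies in the homogeneous prime ideals of
the images of its points. -/
lemma VanishesOn.mem_asHomogeneousIdeal {F : MvPolynomial σ k} {e : ℕ} (hF : VanishesOn p F)
    (he : F.IsHomogeneous e) (z : T) : F ∈ (p z).asHomogeneousIdeal.toIdeal := by
  obtain ⟨j, hj⟩ := exists_mem_chart (p z)
  by_contra hFz
  have hX := MvPolynomial.isHomogeneous_X k j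
  have hunit : p z ∈ (PSpace σ k).basicOpen (fraction hX he) :=
    mem_basicOpen_awayToSection (MvPolynomial.homogeneousSubmodule σ k) _ hj _ hFz
  have hz : z ∈ p ⁻¹ᵁ (PSpace σ k).basicOpen (fraction hX he) := hunit
  rw [Scheme.preimage_basicOpen, (vanishesOn_iff_app p he).mp hF j,
    Scheme.basicOpen_zero] at hz
  exact hz

/-- Every function on the affine open set `{L ≠ 0}` is a fraction with denominator a power of
`L`. -/
lemma exists_eq_fraction {L : MvPolynomial σ k} (hL : L.IsHomogeneous 1)
    (x : Γ(PSpace σ k, nonzeroLocus L)) :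
    ∃ (e : ℕ) (F : MvPolynomial σ k) (hF : F.IsHomogeneous e), x = fraction hL hF := by
  have hL' := (MvPolynomial.mem_homogeneousSubmodule 1 L).mpr hL
  obtain ⟨z, rfl⟩ := (Proj.basicOpenIsoAway (MvPolynomial.homogeneousSubmodule σ k) L hL'
    one_pos).commRingCatIsoToRingEquiv.surjective x
  obtain ⟨e, F, hF, rfl⟩ := HomogeneousLocalization.Away.mk_surjective _ hL' z
  exact ⟨e, F, by simpa using hF, rfl⟩

/-- The functions on a closed subscheme of `{L ≠ 0}` are the polynomials in the coordinates. -/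
lemma exists_eq_eval₂_coord [IsClosedImmersion p] {L : MvPolynomial σ k} (hL : L.IsHomogeneous 1)
    (hp : ⊤ ≤ p ⁻¹ᵁ nonzeroLocus L) (x : Γ(T, ⊤)) :
    ∃ F : MvPolynomial σ k, x = F.eval₂ (scalars (p ≫ PSpace.toSpec σ k)) (coord p hL ⊤ hp) := by
  have hsurj : Function.Surjective (p.appLE _ ⊤ hp).hom := by
    have (O : T.Opens) (hO : O = p ⁻¹ᵁ nonzeroLocus L) :
        Function.Surjective (p.appLE _ O hO.le).hom := by
      subst hO
      rw [Scheme.Hom.appLE_eq_app]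
      exact p.app_surjective _ (isAffineOpen_nonzeroLocus hL)
    exact this ⊤ (hp.antisymm le_top)
  obtain ⟨w, rfl⟩ := hsurj x
  obtain ⟨e, F, hF, rfl⟩ := exists_eq_fraction hL w
  exact ⟨F, by rw [← scalarsOn_top, eval₂_coord p hL ⊤ hp hF]⟩

end Points

instance PSpace.toSpec_isSeparated {σ : Type} {k : Type u} [Field k] :
    IsSeparated (PSpace.toSpec σ k) := by
  have h1 : Function.Bijective (algebraMap k (MvPolynomial.homogeneousSubmodule σ k 0)) := by
    refine ⟨fun a b hab => MvPolynomial.C_injective σ k (congrArg Subtype.val hab), ?_⟩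
    rintro ⟨F, hF⟩
    refine ⟨F.coeff 0, Subtype.ext ?_⟩
    exact (MvPolynomial.totalDegree_eq_zero_iff_eq_C.mp
      (Nat.le_zero.mp (MvPolynomial.IsHomogeneous.totalDegree_le hF))).symm
  have h2 : IsIso (CommRingCat.ofHom (algebraMap k (MvPolynomial.homogeneousSubmodule σ k 0))) :=
    (RingEquiv.ofBijective _ h1).toCommRingCatIso.isIso_hom
  rw [PSpace.toSpec]
  infer_instance

/-! ### Fibres of finite families -/

namespace Family

section Fibres

variable {σ : Type} {k : Type u} [Field k] {X : Scheme.{u}} {i : X ⟶ PSpace σ k} {𝓡 : Family i}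
  {q : Spec (.of k) ⟶ 𝓡.Q} {Z : Scheme.{u}} {fst : Z ⟶ 𝓡.R} {snd : Z ⟶ Spec (.of k)}

lemma comp_toP_toSpec (hq : q ≫ 𝓡.base = 𝟙 _) (hZ : IsPullback fst snd 𝓡.toBase q) :
    (fst ≫ 𝓡.toP) ≫ PSpace.toSpec σ k = snd := by
  rw [toP, Category.assoc, Category.assoc, ← 𝓡.comm, hZ.w_assoc, hq, Category.comp_id]

/-- The fibres over `k`-points of a family of subschemes map monomorphically to projective space. -/
lemma mono_fibre [Mono i] (hq : q ≫ 𝓡.base = 𝟙 _) (hZ : IsPullback fst snd 𝓡.toBase q) :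
    Mono (fst ≫ 𝓡.toP) where
  right_cancellation {Y} u v huv := by
    have hsnd : u ≫ snd = v ≫ snd := by
      have := congr($huv ≫ PSpace.toSpec σ k)
      have h := comp_toP_toSpec hq hZ
      rw [Category.assoc] at h
      simpa only [Category.assoc, h] using this
    have := 𝓡.isImmersion
    refine hZ.hom_ext ?_ hsnd
    rw [← cancel_mono (pullback.lift 𝓡.toBase 𝓡.toX 𝓡.comm)]
    refine pullback.hom_ext ?_ ?_
    · simp only [Category.assoc, pullback.lift_fst, hZ.w, reassoc_of% hsnd]
    · rw [← cancel_mono i]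
      simpa only [Category.assoc, pullback.lift_snd, toP] using huv

/-- The fibres over `k`-points of a finite family of subschemes are closed subschemes of projective
space, because finite monomorphisms are closed immersions. -/
lemma isClosedImmersion_fibre [Mono i] [IsFinite 𝓡.toBase] (hq : q ≫ 𝓡.base = 𝟙 _)
    (hZ : IsPullback fst snd 𝓡.toBase q) : IsClosedImmersion (fst ≫ 𝓡.toP) := by
  have hsnd : IsFinite snd := MorphismProperty.of_isPullback hZ inferInstance
  have : IsFinite ((fst ≫ 𝓡.toP) ≫ PSpace.toSpec σ k) := by rwa [comp_toP_toSpec hq hZ]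
  have := IsFinite.of_comp (fst ≫ 𝓡.toP) (PSpace.toSpec σ k)
  exact (IsClosedImmersion.iff_isFinite_and_mono _).mpr ⟨inferInstance, mono_fibre hq hZ⟩

lemma finite_of_isFinite_toSpec [IsFinite snd] : Finite Z := by
  have := snd.finite_preimage_singleton (default : PrimeSpectrum k)
  refine Set.finite_univ_iff.mp (this.subset fun z _ => ?_)
  exact Subsingleton.elim (α := PrimeSpectrum k) _ _

lemma scalars_finite [IsFinite snd] : (scalars snd).Finite := by
  have h1 := snd.finite_app ⊤ (isAffineOpen_top _)
  rw [scalars, CommRingCat.hom_comp]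
  exact h1.comp (RingHom.Finite.of_surjective _
    (Scheme.ΓSpecIso (.of k)).symm.commRingCatIsoToRingEquiv.surjective)

/-- If `{L ≠ 0}` contains a fibre of a finite family, then it contains the family over a
neighbourhood. -/
lemma exists_affine_nhd [IsFinite 𝓡.toBase] (hZ : IsPullback fst snd 𝓡.toBase q)
    (L : MvPolynomial σ k) (hL : ∀ z : Z, (fst ≫ 𝓡.toP) z ∈ nonzeroLocus L)
    (y : Spec (.of k)) : ∃ U : 𝓡.Q.Opens, IsAffineOpen U ∧ q y ∈ U ∧
      𝓡.toBase ⁻¹ᵁ U ≤ 𝓡.toP ⁻¹ᵁ nonzeroLocus L := by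
  -- the image of the bad locus is closed, because finite morphisms are closed
  have hcl : IsClosed (𝓡.toBase '' ((𝓡.toP ⁻¹ᵁ nonzeroLocus L : Set 𝓡.R)ᶜ)) :=
    𝓡.toBase.isClosedMap _ (𝓡.toP ⁻¹ᵁ nonzeroLocus L).isOpen.isClosed_compl
  have hy : q y ∈ (𝓡.toBase '' ((𝓡.toP ⁻¹ᵁ nonzeroLocus L : Set 𝓡.R)ᶜ))ᶜ := by
    rintro ⟨x, hx, hxy⟩
    obtain ⟨w, hw, -⟩ := Scheme.Pullback.exists_preimage_pullback (f := 𝓡.toBase) (g := q) x y hxy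
    refine hx ?_
    have h1 := hL (hZ.isoPullback.inv w)
    have h2 : fst (hZ.isoPullback.inv w) = x := by
      rw [← Scheme.Hom.comp_apply, hZ.isoPullback_inv_fst, hw]
    rw [Scheme.Hom.comp_apply, h2] at h1
    exact h1
  obtain ⟨_, ⟨(U : 𝓡.Q.Opens), hU, rfl⟩, hyU, hUle⟩ :=
    𝓡.Q.isBasis_affineOpens.exists_subset_of_mem_open hy hcl.isOpen_compl
  refine ⟨U, hU, hyU, fun x hx => ?_⟩
  by_contra hn
  exact hUle hx ⟨x, hn, rfl⟩

end Fibres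

/-! ### Finite subschemes of the Veronese variety -/

section Veronese

variable {k : Type u} [Field k] {n d : ℕ} {𝓡 : Family (veronese k n d).subschemeι}

lemma vanishesOn_toP {e : ℕ} {F : MvPolynomial (Mon n d) k} (hF : F ∈ veroneseIdeal k n d)
    (he : F.IsHomogeneous e) : VanishesOn 𝓡.toP F :=
  (vanishesOn_zeroScheme hF he).comp _ 𝓡.toX

/-- A finite scheme over the Veronese variety avoids a hyperplane of the form `h ^ d = 0`. -/
lemma exists_linearForm_ne_zero [Infinite k] (hd : 1 ≤ d) {Z : Scheme.{u}} [Finite Z]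
    (p : Z ⟶ 𝓡.R) : ∃ h : Fin (n + 1) → k,
      ∀ z : Z, (p ≫ 𝓡.toP) z ∈ nonzeroLocus (linForm d (linearForm h ^ d)) := by
  have := fun z : Z => ((p ≫ 𝓡.toP) z).isPrime
  obtain ⟨h, hh⟩ := exists_linearForm_avoiding hd
    (fun z : Z => ((p ≫ 𝓡.toP) z).asHomogeneousIdeal.toIdeal)
    (fun z e F hF he => ((vanishesOn_toP hF he).comp _ p).mem_asHomogeneousIdeal _ he z)
    (fun z => exists_mem_chart ((p ≫ 𝓡.toP) z))
  exact ⟨h, hh⟩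

/-- The functions `y_l = α_l h ^ (d - 1) / h ^ d` on an open set of a scheme over the projective
space of `S^(d) V`. -/
def affineCoord {T : Scheme.{u}} (p : T ⟶ PSpace (Mon n d) k) (h : Fin (n + 1) → k)
    (O : T.Opens) (hO : O ≤ p ⁻¹ᵁ nonzeroLocus (linForm d (linearForm h ^ d)))
    (l : Fin (n + 1)) : Γ(T, O) :=
  (linForm d (MvPolynomial.X l * linearForm h ^ (d - 1))).eval₂ (scalarsOn p O)
    (coord p (linForm_isHomogeneous _) O hO)

lemma eval₂_linForm_self {T : Scheme.{u}} (p : T ⟶ PSpace (Mon n d) k) (h : Fin (n + 1) → k)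
    (O : T.Opens) (hO : O ≤ p ⁻¹ᵁ nonzeroLocus (linForm d (linearForm h ^ d))) :
    (linForm d (linearForm h ^ d)).eval₂ (scalarsOn p O)
      (coord p (linForm_isHomogeneous _) O hO) = 1 := by
  rw [eval₂_coord p _ O hO (linForm_isHomogeneous _), fraction_self, map_one]

/-- The function `1 = h ^ d / h ^ d` is the combination of the `y_l` with the coefficients
of `h`. -/
lemma sum_affineCoord (hd : 1 ≤ d) {T : Scheme.{u}} (p : T ⟶ PSpace (Mon n d) k)
    (h : Fin (n + 1) → k) (O : T.Opens)
    (hO : O ≤ p ⁻¹ᵁ nonzeroLocus (linForm d (linearForm h ^ d))) :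
    ∑ l, scalarsOn p O (h l) * affineCoord p h O hO l = 1 := by
  have hsum : linearForm h ^ d = ∑ l, h l • (MvPolynomial.X l * linearForm h ^ (d - 1)) := by
    simp_rw [← smul_mul_assoc]
    rw [← Finset.sum_mul, ← linearForm_apply, ← pow_succ', Nat.sub_add_cancel hd]
  have key (t : Mon n d → Γ(T, O)) : ∑ l, scalarsOn p O (h l) *
      (linForm d (MvPolynomial.X l * linearForm h ^ (d - 1))).eval₂ (scalarsOn p O) t =
      (linForm d (linearForm h ^ d)).eval₂ (scalarsOn p O) t := by
    conv_rhs => rw [hsum, map_sum, ← MvPolynomial.coe_eval₂Hom, map_sum]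
    refine Finset.sum_congr rfl fun l _ => ?_
    rw [map_smul, MvPolynomial.smul_eq_C_mul, MvPolynomial.coe_eval₂Hom, MvPolynomial.eval₂_mul,
      MvPolynomial.eval₂_C]
  exact (key _).trans (eval₂_linForm_self p h O hO)

/-- On the Veronese variety, the coordinates `z_m / h ^ d` are the monomials in the `y_l`. -/
lemma coord_eq_prod (hd : 1 ≤ d) {T : Scheme.{u}} (p : T ⟶ PSpace (Mon n d) k)
    (hp : ∀ (e : ℕ) (F : MvPolynomial (Mon n d) k), F ∈ veroneseIdeal k n d → F.IsHomogeneous e →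
      VanishesOn p F) (h : Fin (n + 1) → k) (O : T.Opens)
    (hO : O ≤ p ⁻¹ᵁ nonzeroLocus (linForm d (linearForm h ^ d))) (m : Mon n d) :
    coord p (linForm_isHomogeneous _) O hO m = ∏ l, affineCoord p h O hO l ^ m.1 l :=
  eval₂_coordinates_eq_monomial (scalarsOn p O) _ hd (linearForm_isHomogeneous h)
    (fun e F hF he => (formVanishes_iff p _ hO he).mp ((hp e F hF he).formVanishes p O))
    (eval₂_linForm_self p h O hO) m

/-- A finite closed subscheme of the Veronese variety of degree at most `i + 1` imposes independent
conditions on forms of degree `i`: the monomials of degree `i` span its functions. -/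
lemma exists_spanning_monomials (hd : 1 ≤ d) {T : Scheme.{u}} (p : T ⟶ PSpace (Mon n d) k)
    [IsClosedImmersion p]
    (hp : ∀ (e : ℕ) (F : MvPolynomial (Mon n d) k), F ∈ veroneseIdeal k n d → F.IsHomogeneous e →
      VanishesOn p F) (h : Fin (n + 1) → k)
    (hO : ⊤ ≤ p ⁻¹ᵁ nonzeroLocus (linForm d (linearForm h ^ d)))
    (hfin : (scalars (p ≫ PSpace.toSpec (Mon n d) k)).Finite) {i : ℕ}
    (hi : degree (p ≫ PSpace.toSpec (Mon n d) k) ≤ i + 1) :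
    ∃ s : Fin (degree (p ≫ PSpace.toSpec (Mon n d) k)) → Mon n i, ∀ x : Γ(T, ⊤),
      ∃ c : Fin (degree (p ≫ PSpace.toSpec (Mon n d) k)) → k,
        x = ∑ l, scalars (p ≫ PSpace.toSpec (Mon n d) k) (c l) *
          ∏ j, affineCoord p h ⊤ hO j ^ (s l).1 j := by
  let : Algebra k Γ(T, ⊤) := (scalars (p ≫ PSpace.toSpec (Mon n d) k)).toAlgebra
  have : Module.Finite k Γ(T, ⊤) := hfin
  have halg (c : k) : algebraMap k Γ(T, ⊤) c = scalarsOn p ⊤ c := by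
    rw [scalarsOn_top]
    rfl
  set y := affineCoord p h ⊤ hO with hy
  have h1 : 1 ∈ Submodule.span k (Set.range y) := by
    rw [← sum_affineCoord hd p h ⊤ hO]
    refine sum_mem fun l _ => ?_
    rw [← halg, ← Algebra.smul_def]
    exact Submodule.smul_mem _ _ (Submodule.subset_span ⟨l, rfl⟩)
  have hgen : Algebra.adjoin k (Set.range y) = ⊤ := by
    refine eq_top_iff.mpr fun x _ => ?_
    obtain ⟨F, rfl⟩ := exists_eq_eval₂_coord p (linForm_isHomogeneous _) hO x
    induction F using MvPolynomial.induction_on with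
    | C c =>
      rw [MvPolynomial.eval₂_C]
      exact Subalgebra.algebraMap_mem _ c
    | add F G hF hG =>
      rw [MvPolynomial.eval₂_add]
      exact add_mem (hF trivial) (hG trivial)
    | mul_X F m hF =>
      rw [MvPolynomial.eval₂_mul, MvPolynomial.eval₂_X, coord_eq_prod hd p hp h ⊤ hO m]
      exact mul_mem (hF trivial) (prod_mem fun l _ =>
        pow_mem (Algebra.subset_adjoin (Set.mem_range_self l)) _)
  have hspan := span_monomials_eq_top (i := i) y h1 hgen hi
  obtain ⟨s, hs⟩ := exists_spanning_subfamily _ hspan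
  refine ⟨s, fun x => ?_⟩
  have hx : x ∈ Submodule.span k (Set.range ((fun m : Mon n i => MvPolynomial.aeval y
    (MvPolynomial.monomial m.1 (1 : k))) ∘ s)) := by rw [hs]; trivial
  obtain ⟨c, hc⟩ := (Submodule.mem_span_range_iff_exists_fun k).mp hx
  refine ⟨c, hc.symm.trans (Finset.sum_congr rfl fun l _ => ?_)⟩
  rw [Algebra.smul_def, Function.comp_apply, MvPolynomial.aeval_monomial, map_one, one_mul,
    Finsupp.prod_fintype _ _ fun _ => pow_zero _]
  rfl

end Veronese

end Family

/-! ### Linear equations of families on the Veronese variety -/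

section SyzygyForms

variable {n d : ℕ}

/-- The linear form `f z_{ab} - ∑_l g_l z_{s_l b}` over a ring. -/
def syzygyForm {A : Type u} [CommRing A] {i : ℕ} (hi : i ≤ d) {ι : Type} [Fintype ι]
    (f : A) (g : ι → A) (s : ι → Mon n i) (a : Mon n i) (b : Mon n (d - i)) :
    MvPolynomial (Mon n d) A :=
  MvPolynomial.C f * MvPolynomial.X ⟨a.1 + b.1, by
    rw [map_add, a.2, b.2, Nat.add_sub_cancel' hi]⟩ -
  ∑ l, MvPolynomial.C (g l) * MvPolynomial.X ⟨(s l).1 + b.1, by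
    rw [map_add, (s l).2, b.2, Nat.add_sub_cancel' hi]⟩

lemma syzygyForm_isHomogeneous {A : Type u} [CommRing A] {i : ℕ} (hi : i ≤ d) {ι : Type}
    [Fintype ι] (f : A) (g : ι → A) (s : ι → Mon n i) (a : Mon n i) (b : Mon n (d - i)) :
    (syzygyForm hi f g s a b).IsHomogeneous 1 := by
  refine MvPolynomial.IsHomogeneous.sub ?_ (MvPolynomial.IsHomogeneous.sum _ _ _ fun l _ => ?_)
  · simpa using (MvPolynomial.isHomogeneous_C _ f).mul (MvPolynomial.isHomogeneous_X A _)
  · simpa using (MvPolynomial.isHomogeneous_C _ (g l)).mul (MvPolynomial.isHomogeneous_X A _)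

lemma eval₂_syzygyForm {A : Type u} {B : Type*} [CommRing A] [CommRing B] (φ : A →+* B)
    (t : Mon n d → B) {i : ℕ} (hi : i ≤ d) {ι : Type}
    [Fintype ι] (f : A) (g : ι → A) (s : ι → Mon n i) (a : Mon n i) (b : Mon n (d - i)) :
    (syzygyForm hi f g s a b).eval₂ φ t = φ f * t ⟨a.1 + b.1, by
      rw [map_add, a.2, b.2, Nat.add_sub_cancel' hi]⟩ -
      ∑ l, φ (g l) * t ⟨(s l).1 + b.1, by
        rw [map_add, (s l).2, b.2, Nat.add_sub_cancel' hi]⟩ := by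
  rw [syzygyForm, ← MvPolynomial.coe_eval₂Hom]
  simp only [map_sub, map_sum, map_mul, MvPolynomial.coe_eval₂Hom, MvPolynomial.eval₂_C,
    MvPolynomial.eval₂_X]

end SyzygyForms

namespace Family

lemma affineCoord_comp {k : Type u} [Field k] {n d : ℕ} {T T' : Scheme.{u}}
    (p : T ⟶ PSpace (Mon n d) k) (g : T' ⟶ T) (h : Fin (n + 1) → k) {O : T.Opens} {O' : T'.Opens}
    (hO : O ≤ p ⁻¹ᵁ nonzeroLocus (linForm d (linearForm h ^ d))) (hOO : O' ≤ g ⁻¹ᵁ O)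
    (hO' : O' ≤ (g ≫ p) ⁻¹ᵁ nonzeroLocus (linForm d (linearForm h ^ d))) (l : Fin (n + 1)) :
    (g.appLE O O' hOO).hom (affineCoord p h O hO l) = affineCoord (g ≫ p) h O' hO' l := by
  rw [affineCoord, MvPolynomial.hom_eval₂, scalarsOn_comp]
  have : (fun m => (g.appLE O O' hOO).hom (coord p (linForm_isHomogeneous
      (linearForm h ^ d)) O hO m)) = coord (g ≫ p) (linForm_isHomogeneous _) O' hO' :=
    funext fun m => coord_comp p g _ hOO hO hO' m
  rw [this]
  rfl

section Fibres

variable {σ : Type} {k : Type u} [Field k] {X : Scheme.{u}} {i : X ⟶ PSpace σ k} {𝓡 : Family i}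
  {q : Spec (.of k) ⟶ 𝓡.Q} {Z : Scheme.{u}} {fst : Z ⟶ 𝓡.R} {snd : Z ⟶ Spec (.of k)}

/-- The functions on a fibre are the base change of the functions on the family over an affine
open set. -/
lemma isPushout_sections [IsFinite 𝓡.toBase] (hZ : IsPullback fst snd 𝓡.toBase q)
    {U : 𝓡.Q.Opens} (hU : IsAffineOpen U) (hqU : ⊤ ≤ q ⁻¹ᵁ U)
    (hfst : ⊤ ≤ fst ⁻¹ᵁ 𝓡.toBase ⁻¹ᵁ U) :
    IsPushout (𝓡.toBase.appLE U (𝓡.toBase ⁻¹ᵁ U) le_rfl) (q.appLE U ⊤ hqU)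
      (fst.appLE (𝓡.toBase ⁻¹ᵁ U) ⊤ hfst) (snd.appLE ⊤ ⊤ (le_preimage_top _ _)) := by
  have hUY : (⊤ : Z.Opens) = fst ⁻¹ᵁ (𝓡.toBase ⁻¹ᵁ U) ⊓ snd ⁻¹ᵁ ⊤ :=
    (le_inf hfst (le_preimage_top _ _)).antisymm le_top
  exact (isIso_pushoutSection_iff hZ hqU le_rfl hUY).mp
    (isIso_pushoutSection_of_isAffineOpen hZ hqU le_rfl hUY hU (isAffineOpen_top _)
      (hU.preimage _))

/-- The inclusion of the constants splits the evaluation of functions at a `k`-point. -/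
lemma section_comp_eq_id (hq : q ≫ 𝓡.base = 𝟙 _) (U : 𝓡.Q.Opens) (hqU : ⊤ ≤ q ⁻¹ᵁ U) :
    𝓡.base.appLE ⊤ U (le_preimage_top _ _) ≫ q.appLE U ⊤ hqU = 𝟙 _ := by
  rw [Scheme.Hom.appLE_comp_appLE]
  have (f : Spec (.of k) ⟶ Spec (.of k)) (hf : f = 𝟙 _) :
      f.appLE ⊤ ⊤ (le_preimage_top _ _) = 𝟙 _ := by
    subst hf
    rw [Scheme.Hom.appLE, Scheme.Hom.id_app]
    exact (Category.id_comp _).trans (CategoryTheory.Functor.map_id _ _)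
  exact this _ hq

lemma mem_basicOpen_of_eq_one {U : 𝓡.Q.Opens} (hqU : ⊤ ≤ q ⁻¹ᵁ U) {f : Γ(𝓡.Q, U)}
    (hf : (q.appLE U ⊤ hqU).hom f = 1) (y : Spec (.of k)) : q y ∈ 𝓡.Q.basicOpen f := by
  have h := Scheme.basicOpen_appLE q (⊤ : (Spec (.of k)).Opens) U hqU f
  have h2 : (Spec (.of k)).basicOpen ((q.appLE U ⊤ hqU).hom f) = ⊤ := by
    rw [hf]
    exact Scheme.basicOpen_of_isUnit _ isUnit_one
  have h3 : y ∈ (Spec (.of k)).basicOpen ((q.appLE U ⊤ hqU).hom f) := by rw [h2]; trivial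
  have h4 := h.le h3
  exact h4.2

lemma appLE_scalars (snd : Z ⟶ Spec (.of k)) (c : k) :
    (snd.appLE ⊤ ⊤ (le_preimage_top _ _)).hom ((Scheme.ΓSpecIso (.of k)).inv.hom c) =
      scalars snd c := by
  have : snd.appLE ⊤ ⊤ (le_preimage_top _ _) = snd.appTop := snd.appLE_eq_app
  rw [this]
  rfl

end Fibres

section Veronese

variable {k : Type u} [Field k] {n d : ℕ} {𝓡 : Family (veronese k n d).subschemeι}

/-- A relation between monomials of degree `i` becomes a linear equation of the family after
multiplication by a monomial of degree `d - i`. -/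
lemma inIdeal_syzygyForm (hd : 1 ≤ d) (h : Fin (n + 1) → k) {U : 𝓡.Q.Opens}
    (hU : 𝓡.toBase ⁻¹ᵁ U ≤ 𝓡.toP ⁻¹ᵁ nonzeroLocus (linForm d (linearForm h ^ d)))
    {i : ℕ} (hi : i ≤ d) {ι : Type} [Fintype ι] (f : Γ(𝓡.Q, U)) (g : ι → Γ(𝓡.Q, U))
    (s : ι → Mon n i) (a : Mon n i)
    (hrel : (𝓡.toBase.app U).hom f * ∏ j, affineCoord 𝓡.toP h _ hU j ^ a.1 j =
      ∑ l, (𝓡.toBase.app U).hom (g l) * ∏ j, affineCoord 𝓡.toP h _ hU j ^ (s l).1 j)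
    (b : Mon n (d - i)) : 𝓡.InIdeal U (syzygyForm hi f g s a b) := by
  refine (formVanishes_iff 𝓡.toP (linForm_isHomogeneous _) hU
    (syzygyForm_isHomogeneous hi f g s a b)).mpr ?_
  have key (m : Mon n i) : coord 𝓡.toP (linForm_isHomogeneous _) _ hU ⟨m.1 + b.1, by
      rw [map_add, m.2, b.2, Nat.add_sub_cancel' hi]⟩ =
      (∏ j, affineCoord 𝓡.toP h _ hU j ^ m.1 j) * ∏ j, affineCoord 𝓡.toP h _ hU j ^ b.1 j := by
    rw [coord_eq_prod hd 𝓡.toP (fun e F hF he => vanishesOn_toP hF he) h _ hU,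
      ← Finset.prod_mul_distrib]
    exact Finset.prod_congr rfl fun j _ => by rw [← pow_add]; rfl
  rw [eval₂_syzygyForm, sub_eq_zero, key]
  simp_rw [key, ← mul_assoc]
  rw [← Finset.sum_mul]
  exact congrArg (· * _) hrel

/-- Near a `k`-point of the base, the rows of the catalecticant matrix are, on the linear span of
a family of degree at most `i + 1`, combinations of as many rows as the degree. -/
lemma exists_syzygies [Infinite k] (hd : 1 ≤ d) [IsFinite 𝓡.toBase] {q : Spec (.of k) ⟶ 𝓡.Q}
    (hq : q ≫ 𝓡.base = 𝟙 _) {Z : Scheme.{u}} {fst : Z ⟶ 𝓡.R} {snd : Z ⟶ Spec (.of k)}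
    (hZ : IsPullback fst snd 𝓡.toBase q) {i : ℕ} (hi : i ≤ d) (hdeg : degree snd ≤ i + 1)
    (y : Spec (.of k)) :
    ∃ (U : 𝓡.Q.Opens) (f : Γ(𝓡.Q, U)), q y ∈ 𝓡.Q.basicOpen f ∧
      ∃ (s : Fin (degree snd) → Mon n i) (g : Mon n i → Fin (degree snd) → Γ(𝓡.Q, U)),
        ∀ a b, 𝓡.InIdeal U (syzygyForm hi f (g a) s a b) := by
  have hsnd : IsFinite snd := MorphismProperty.of_isPullback hZ inferInstance
  have : Finite Z := finite_of_isFinite_toSpec (snd := snd)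
  obtain ⟨h, hh⟩ := exists_linearForm_ne_zero hd fst
  obtain ⟨U, hUaff, hyU, hU⟩ := exists_affine_nhd hZ _ hh y
  have hqU : ⊤ ≤ q ⁻¹ᵁ U := fun z _ => by
    rwa [Subsingleton.elim (α := PrimeSpectrum k) z y]
  have hfst : ⊤ ≤ fst ⁻¹ᵁ 𝓡.toBase ⁻¹ᵁ U := by
    intro z _
    change 𝓡.toBase (fst z) ∈ U
    rw [← Scheme.Hom.comp_apply, hZ.w]
    exact hqU trivial
  have hcl := isClosedImmersion_fibre hq hZ
  have hstr := comp_toP_toSpec hq hZ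
  subst hstr
  obtain ⟨s, hs⟩ := exists_spanning_monomials (i := i) hd (fst ≫ 𝓡.toP)
    (fun e F hF he => (vanishesOn_toP hF he).comp _ fst) h (fun z _ => hh z)
    (scalars_finite) hdeg
  obtain ⟨f, hf, hfB⟩ := exists_smul_mem_span (isPushout_sections hZ hUaff hqU hfst)
    (𝓡.base.appLE ⊤ U (le_preimage_top _ _)) (section_comp_eq_id hq U hqU)
    (by rw [Scheme.Hom.appLE_eq_app]; exact 𝓡.toBase.finite_app U hUaff)
    (fun l => ∏ j, affineCoord 𝓡.toP h _ hU j ^ (s l).1 j) (by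
      intro x
      obtain ⟨c, hc⟩ := hs x
      refine ⟨fun l => (Scheme.ΓSpecIso (.of k)).inv.hom (c l), hc.trans ?_⟩
      refine Finset.sum_congr rfl fun l _ => ?_
      rw [map_prod]
      simp_rw [map_pow, affineCoord_comp 𝓡.toP fst h hU hfst (fun z _ => hh z)]
      exact congrArg (· * _) (appLE_scalars _ _).symm)
  -- clear denominators simultaneously for all the monomials of degree `i`
  choose g hg using fun a : Mon n i => hfB (∏ j, affineCoord 𝓡.toP h _ hU j ^ a.1 j)
  refine ⟨U, f, mem_basicOpen_of_eq_one hqU hf y, s, g, fun a b => ?_⟩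
  refine inIdeal_syzygyForm hd h hU hi f (g a) s a ?_ b
  have := hg a
  rwa [Scheme.Hom.appLE_eq_app] at this

end Veronese

end Family

/-! ### Vanishing of the catalecticant minors -/

lemma det_mul_eq_zero_of_card_lt {B m ι : Type*} [CommRing B] [Fintype m] [DecidableEq m]
    [Fintype ι] (h : Fintype.card ι < Fintype.card m) (G : Matrix m ι B) (N : Matrix ι m B) :
    (G * N).det = 0 := by
  have hcard : Fintype.card (ι ⊕ Fin (Fintype.card m - Fintype.card ι)) = Fintype.card m := by
    rw [Fintype.card_sum, Fintype.card_fin]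
    omega
  let e := Fintype.equivOfCardEq hcard
  -- pad both factors by zeros to square matrices
  let G' : Matrix m (ι ⊕ Fin (Fintype.card m - Fintype.card ι)) B := Matrix.fromCols G 0
  let N' : Matrix (ι ⊕ Fin (Fintype.card m - Fintype.card ι)) m B := Matrix.fromRows N 0
  have h1 : G * N = G' * N' := by
    rw [Matrix.fromCols_mul_fromRows, Matrix.mul_zero, add_zero]
  have h2 : G' * N' = G'.submatrix id e.symm * N'.submatrix e.symm id := by
    rw [Matrix.submatrix_mul_equiv, Matrix.submatrix_id_id]
  rw [h1, h2, Matrix.det_mul, Matrix.det_eq_zero_of_column_eq_zero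
    (e (Sum.inr ⟨0, Nat.sub_pos_of_lt h⟩)), zero_mul]
  intro x
  rw [Matrix.submatrix_apply, Equiv.symm_apply_apply]
  rfl

/-- If all the rows of `M` are, up to a unit, combinations of fewer rows than its size, then the
determinant is zero. -/
lemma det_eq_zero_of_smul_eq_mul {B m ι : Type*} [CommRing B] [Fintype m] [DecidableEq m]
    [Fintype ι] (h : Fintype.card ι < Fintype.card m) {f : B} (hf : IsUnit f) (M : Matrix m m B)
    (G : Matrix m ι B) (N : Matrix ι m B) (hM : f • M = G * N) : M.det = 0 := by
  have := det_mul_eq_zero_of_card_lt h G N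
  rw [← hM, Matrix.det_smul] at this
  exact (hf.pow _).mul_right_eq_zero.mp this

lemma FormVanishes.eval₂_coord {σ : Type} {k : Type u} [Field k] {T : Scheme.{u}}
    {p : T ⟶ PSpace σ k} {O : T.Opens} {A : Type u} [CommRing A] {φ : A →+* Γ(T, O)}
    {F : MvPolynomial σ A} (h : FormVanishes p O φ F) (j : σ) {V : T.Opens} (hV : V ≤ O)
    (hj : V ≤ p ⁻¹ᵁ chart k j) : F.eval₂ ((T.presheaf.map (homOfLE hV).op).hom.comp φ)
      (coord p (MvPolynomial.isHomogeneous_X k j) V hj) = 0 := by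
  have := congr((T.presheaf.map (homOfLE (le_inf hV hj)).op).hom
    $((formVanishes_iff_charts p).mp h j))
  rw [res_eval₂_coord, map_zero, ← RingHom.comp_assoc, ← CommRingCat.hom_comp,
    ← Functor.map_comp] at this
  exact this

section Minors

variable {k : Type u} [Field k] {n d : ℕ}

lemma eval₂_catalecticant_minor {B : Type*} [CommRing B] (φ : k →+* B) (t : Mon n d → B) {i : ℕ}
    (hi : i ≤ d) {s : ℕ} (a : Fin s → Mon n i) (b : Fin s → Mon n (d - i)) :
    (((catalecticant k n d i hi).submatrix a b).det).eval₂ φ t =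
      (Matrix.of fun x y => t ⟨(a x).1 + (b y).1, by
        rw [map_add, (a x).2, (b y).2, Nat.add_sub_cancel' hi]⟩).det := by
  rw [← MvPolynomial.coe_eval₂Hom, RingHom.map_det]
  congr 1
  ext x y
  exact MvPolynomial.eval₂_X _ _ _

/-- A matrix `t_{ab}` whose rows satisfy the relations `f t_{ab} = ∑_l g_{al} t_{s_l b}` with `f` a
unit has no nonzero minor with more rows than there are indices `l`. -/
lemma minor_eq_zero {A : Type u} {B : Type*} [CommRing A] [CommRing B] (φ : A →+* B)
    (t : Mon n d → B) {i : ℕ} (hi : i ≤ d) {r r' : ℕ} (hr : r' ≤ r) {f : A} (hf : IsUnit (φ f))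
    (s : Fin r' → Mon n i) (g : Mon n i → Fin r' → A)
    (h : ∀ a b, (syzygyForm hi f (g a) s a b).eval₂ φ t = 0)
    (a : Fin (r + 1) → Mon n i) (b : Fin (r + 1) → Mon n (d - i)) :
    (Matrix.of fun x y => t ⟨(a x).1 + (b y).1, by
        rw [map_add, (a x).2, (b y).2, Nat.add_sub_cancel' hi]⟩).det = 0 := by
  refine det_eq_zero_of_smul_eq_mul (by simpa using Nat.lt_succ_of_le hr) hf _
    (Matrix.of fun x l => φ (g (a x) l)) (Matrix.of fun l y => t ⟨(s l).1 + (b y).1, by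
      rw [map_add, (s l).2, (b y).2, Nat.add_sub_cancel' hi]⟩) ?_
  ext x y
  have := h (a x) (b y)
  rw [eval₂_syzygyForm, sub_eq_zero] at this
  rw [Matrix.mul_apply]
  exact this

end Minors

namespace Family

variable {k : Type u} [Field k] {n d : ℕ} {𝓡 : Family (veronese k n d).subschemeι}

/-- The minors of the catalecticant matrix vanish on every scheme over `Q ×ₖ ℙ` on which the
linear equations of the family vanish. -/
lemma IsTight.vanishesOn_minor [Infinite k] (hd : 1 ≤ d) {r r' i : ℕ} (h𝓡 : 𝓡.IsTight r')
    (hr : r' ≤ r) (hri : r ≤ i + 1) (hi : i ≤ d) {T : Scheme.{u}} (p : T ⟶ PSpace (Mon n d) k)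
    (π : T ⟶ 𝓡.Q)
    (hT : ∀ (U : 𝓡.Q.Opens) (F : MvPolynomial (Mon n d) Γ(𝓡.Q, U)), F.IsHomogeneous 1 →
      𝓡.InIdeal U F → FormVanishes p (π ⁻¹ᵁ U) (π.app U).hom F)
    (a : Fin (r + 1) → Mon n i) (b : Fin (r + 1) → Mon n (d - i)) :
    VanishesOn p ((catalecticant k n d i hi).submatrix a b).det := by
  refine (vanishesOn_iff_charts p).mpr fun j => section_eq_zero _ fun x hx => ?_
  obtain ⟨q, hq, y, hy⟩ := h𝓡.enough.2 (π x)
  have := h𝓡.finite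
  have hdeg := h𝓡.degree_fibre ⟨q, hq⟩
  obtain ⟨U, f, hf, s, g, hsyz⟩ := exists_syzygies hd hq (IsPullback.of_hasPullback 𝓡.toBase q) hi
    (hdeg.le.trans (hr.trans hri)) y
  -- the open set `{f ≠ 0}` contains a specialization of `π x`
  have hx' : π x ∈ 𝓡.Q.basicOpen f := by
    obtain ⟨z, hz, hzx⟩ := mem_closure_iff.mp hy _ (𝓡.Q.basicOpen f).isOpen hf
    rwa [Set.mem_singleton_iff.mp hzx] at hz
  have hle : p ⁻¹ᵁ chart k j ⊓ π ⁻¹ᵁ 𝓡.Q.basicOpen f ≤ π ⁻¹ᵁ U :=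
    fun z hz => 𝓡.Q.basicOpen_le f hz.2
  refine ⟨p ⁻¹ᵁ chart k j ⊓ π ⁻¹ᵁ 𝓡.Q.basicOpen f, inf_le_left, ⟨hx, hx'⟩, ?_⟩
  rw [res_eval₂_coord, eval₂_catalecticant_minor]
  refine minor_eq_zero ((T.presheaf.map (homOfLE hle).op).hom.comp (π.app U).hom) _ hi
    (hdeg.trans_le hr) (f := f) ?_ s g (fun a b => ?_) a b
  · have h1 : IsUnit ((𝓡.Q.presheaf.map (homOfLE (𝓡.Q.basicOpen_le f)).op).hom f) :=
      RingedSpace.isUnit_res_basicOpen _ f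
    have h2 := h1.map (π.appLE (𝓡.Q.basicOpen f) (p ⁻¹ᵁ chart k j ⊓ π ⁻¹ᵁ 𝓡.Q.basicOpen f)
      inf_le_right).hom
    rw [← CommRingCat.comp_apply, Scheme.Hom.map_appLE] at h2
    exact h2
  · exact (hT U _ (syzygyForm_isHomogeneous hi f (g a) s a b) (hsyz a b)).eval₂_coord j hle
      inf_le_left

lemma IsTight.vanishesOn_of_mem_minorsIdeal [Infinite k] (hd : 1 ≤ d) {r r' i : ℕ}
    (h𝓡 : 𝓡.IsTight r') (hr : r' ≤ r) (hri : r ≤ i + 1) (hi : i ≤ d) {T : Scheme.{u}}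
    (p : T ⟶ PSpace (Mon n d) k) (π : T ⟶ 𝓡.Q)
    (hT : ∀ (U : 𝓡.Q.Opens) (F : MvPolynomial (Mon n d) Γ(𝓡.Q, U)), F.IsHomogeneous 1 →
      𝓡.InIdeal U F → FormVanishes p (π ⁻¹ᵁ U) (π.app U).hom F)
    {F : MvPolynomial (Mon n d) k} (hF : F ∈ minorsIdeal (catalecticant k n d i hi) (r + 1)) :
    VanishesOn p F := by
  refine (vanishesOn_iff_charts p).mpr fun j => ?_
  have hle : minorsIdeal (catalecticant k n d i hi) (r + 1) ≤
      RingHom.ker (MvPolynomial.eval₂Hom (scalarsOn p (p ⁻¹ᵁ chart k j))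
        (coord p (MvPolynomial.isHomogeneous_X k j) (p ⁻¹ᵁ chart k j) le_rfl)) := by
    refine Ideal.span_le.mpr ?_
    rintro _ ⟨a, b, rfl⟩
    exact (vanishesOn_iff_charts p).mp (h𝓡.vanishesOn_minor hd hr hri hi p π hT a b) j
  exact hle hF

/-- The relative linear span of a family of degree `r' ≤ r` is contained in the locus where the
catalecticant matrix has rank at most `r`. -/
lemma IsTight.upsilon_le_relSpan [Infinite k] (hd : 1 ≤ d) {r r' i : ℕ} (h𝓡 : 𝓡.IsTight r')
    (hr : r' ≤ r) (hri : r ≤ i + 1) (hi : i ≤ d) : upsilon k n d i hi r ≤ 𝓡.relSpan := by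
  -- the relative linear span is the direct image of the span, an infimum of the ideal sheaves `J`
  -- of closed subschemes on which the linear equations of the family hold; by adjunction the
  -- inclusion can be tested on each `J`
  change _ ≤ 𝓡.span.map _
  rw [Scheme.IdealSheafData.le_map_iff_comap_le]
  refine le_sInf fun J hJ => ?_
  rw [← Scheme.IdealSheafData.le_map_iff_comap_le]
  exact zeroScheme_le_ker _ fun e F hF _ => h𝓡.vanishesOn_of_mem_minorsIdeal hd hr hri hi _
    (J.subschemeι ≫ pullback.fst 𝓡.base (PSpace.toSpec (Mon n d) k))
    (fun U F hF hU => hJ U 1 F le_rfl hF hU) hF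

end Family

end

end Cactus

theorem theorem3 (k : Type u) [Field k] [IsAlgClosed k] (n d r i : ℕ) (hr : 1 ≤ r)
    (hri : r ≤ i + 1) (hid : i + 1 ≤ d) :
    ∃ f : (Cactus.cactus (Cactus.veronese k n d).subschemeι r).subscheme ⟶
        (Cactus.upsilon k n d i (Nat.le_of_succ_le hid) r).subscheme,
      f ≫ (Cactus.upsilon k n d i (Nat.le_of_succ_le hid) r).subschemeι =
        (Cactus.cactus (Cactus.veronese k n d).subschemeι r).subschemeι := by
  have hle : Cactus.upsilon k n d i (Nat.le_of_succ_le hid) r ≤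
      Cactus.cactus (Cactus.veronese k n d).subschemeι r := by
    refine le_sInf ?_
    rintro _ ⟨𝓡, r', hr', h𝓡, -, rfl⟩
    exact h𝓡.upsilon_le_relSpan (Nat.one_le_of_lt hid) hr' hri _
  exact ⟨Scheme.IdealSheafData.inclusion hle, Scheme.IdealSheafData.inclusion_subschemeι hle⟩
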